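/- Let $K$ be a field, $S=K[x_1,\dots,x_6]$ with the standard grading, and $I=\langle x_1x_2,\,x_2x_3,\,x_3x_4,\,x_4x_5,\,x_5x_6\rangle$. For $k\ge 1$ let $\beta_{i,j}(S/I^k)$ be the number of basis elements of degree $j$ in the $i$-th module of a minimal graded free resolution of $S/I^k$. For integers $d_0<d_1<\dots<d_c$ ($c\ge 0$), the (normalised) pure diagram of $d=(d_0,\dots,d_c)$ is the diagram whose only nonzero entries are $$\pi(d)_{i,d_i}=\frac{\prod_{l\ne 0}(d_l-d_0)}{\prod_{l\neq i}|d_l-d_i|}\qquad(0\le i\le c),$$ so that $\pi(d)_{0,d_0}=1$. A decomposition of a diagram $\beta$ is an expression of $\beta$ as a finite sum of pure diagrams with nonnegative real weights. For $k\geq 1$ let $\pi_1(k),\dots,\pi_8(k)$ be the pure diagrams of the degree sequences $$\begin{aligned}&(0,2k,2k+1,2k+2),\quad (0,2k,2k+1,2k+3),\quad (0,2k,2k+2,2k+3),\\ &(0,2k,2k+1,2k+2,2k+3),\quad (0,2k,2k+1,2k+2,2k+4),\quad (0,2k,2k+1,2k+3,2k+4),\\ &(0,2k,2k+2,2k+3,2k+4),\quad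 (0,2k,2k+1,2k+2,2k+3,2k+4).\end{aligned}$$ A minimal graded free resolution of $S/I^k$ (with modules of finite rank) exists, and for any such resolution the following hold. 1. For every $k\ge 1$ the nonzero Betti numbers of $S/I^k$ are among $\beta_{0,0}=1$; $$\beta_{1,2k}=\tbinom{k+4}{4},\quad \beta_{2,2k+1}=4\tbinom{k+3}{4},\quad \beta_{3,2k+2}=6\tbinom{k+2}{4},\quad \beta_{4,2k+3}=4\tbinom{k+1}{4},\quad \beta_{5,2k+4}=\tbinom{k}{4};$$ $$\beta_{2,2k+2}=k(k+2),\quad \beta_{3,2k+3}=2k(k+1),\quad \beta_{4,2k+4}=k^2.$$ 2. For every $k\ge 1$, every decomposition of $\beta(S/I^k)$ into pure diagrams uses, with positive weight, only pure diagrams among $\pi_1(k),\dots,\pi_8(k)$. 3. For every $k\ge 3$ the polytope $$P_k=\Big\{w\in\mathbb R_{\ge 0}^8 : \beta(S/I^k)=w_1\pi_1(k)+\dots+w_8\pi_8(k)\Big\}$$ is a (nondegenerate) triangle whose vertices are $$h_1(k)=\Big(0,0,\tfrac{k+2}{2k+3},w_4(k),\tfrac{(2k+5)(k-1)}{(2k+1)(k+2)(k+1)},\tfrac{(4k+5)(k+1)}{(2k+3)(2k+1)(k+2)},0,w_8(k)\Big),$$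 $$h_2(k)=\Big(0,\tfrac{2(k+2)(k+1)}{(2k+3)(2k+1)},0,w_4(k),\tfrac{(2k+5)(k-1)}{(2k+1)(k+2)(k+1)},\tfrac{(k+1)(k-1)}{(2k+3)(2k+1)(k+2)},\tfrac1{2k+3},w_8(k)\Big),$$ $$h_3(k)=\Big(\tfrac{k+2}{2k+1},0,0,w_4(k),\tfrac{k^2-7}{(2k+1)(k+2)(k+1)},\tfrac{k+1}{(2k+3)(k+2)},\tfrac1{2k+3},w_8(k)\Big),$$ where $$w_4(k)=\frac{(7k+15)(k-1)(k-2)}{4(2k+3)(2k+1)(k+1)},\qquad w_8(k)=\frac{(k-1)(k-2)(k-3)}{4(2k+3)(2k+1)(k+1)}.$$ -/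

import Mathlib

noncomputable section

open MvPolynomial

/-- A minimal graded free resolution
`⋯ → F₂ → F₁ → F₀ → S ⧸ J → 0` of `S ⧸ J` over `S = K[x₁,…,xₙ]` with its standard grading.
The module `F i` is free with a finite basis indexed by `Fin (rank i)`, whose `a`-th element is
homogeneous of degree `deg i a`; that is, `F i = ⨁ₐ S(-deg i a)`.  The differential
`F (i+1) → F i` is multiplication by the matrix `d i`. -/
structure MinimalFreeResolution (K : Type*) [Field K] (n : ℕ)
    (J : Ideal (MvPolynomial (Fin n) K)) where
  /-- the rank of the `i`-th free module -/
  rank : ℕ → ℕ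
  /-- the degrees of the homogeneous basis elements -/
  deg : (i : ℕ) → Fin (rank i) → ℕ
  /-- the matrix of the differential `F (i+1) → F i` -/
  d : (i : ℕ) → Matrix (Fin (rank i)) (Fin (rank (i + 1))) (MvPolynomial (Fin n) K)
  /-- the augmentation `F 0 → S ⧸ J` -/
  aug : (Fin (rank 0) → MvPolynomial (Fin n) K) →ₗ[MvPolynomial (Fin n) K]
    (MvPolynomial (Fin n) K ⧸ J)
  /-- the augmentation preserves degrees -/
  aug_homogeneous : ∀ a, ∃ p : MvPolynomial (Fin n) K,
    p.IsHomogeneous (deg 0 a) ∧ aug (Pi.single a 1) = Ideal.Quotient.mk J p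
  /-- the differentials preserve degrees -/
  d_homogeneous : ∀ i a b, d i a b ≠ 0 →
    ∃ m, deg (i + 1) b = deg i a + m ∧ (d i a b).IsHomogeneous m
  aug_surjective : Function.Surjective aug
  exact_zero : Function.Exact (d 0).mulVecLin aug
  exact_succ : ∀ i, Function.Exact (d (i + 1)).mulVecLin (d i).mulVecLin
  /-- minimality: the matrices have entries in the ideal `⟨x₁,…,xₙ⟩` -/
  minimal : ∀ i a b, constantCoeff (d i a b) = 0

/-- The graded Betti number `β_{i,j}`: the number of basis elements of degree `j` in the `i`-th
module of the minimal graded free resolution. -/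
def MinimalFreeResolution.betti {K : Type*} [Field K] {n : ℕ}
    {J : Ideal (MvPolynomial (Fin n) K)} (F : MinimalFreeResolution K n J) (i j : ℕ) : ℕ :=
  (Finset.univ.filter fun a : Fin (F.rank i) => F.deg i a = j).card

/-- The ideal `⟨x₁x₂, x₂x₃, x₃x₄, x₄x₅, x₅x₆⟩` of `K[x₁,…,x₆]`. -/
def pathIdeal (K : Type*) [Field K] : Ideal (MvPolynomial (Fin 6) K) :=
  Ideal.span {X 0 * X 1, X 1 * X 2, X 2 * X 3, X 3 * X 4, X 4 * X 5}

/-- A degree sequence `d₀ < d₁ < ⋯ < d_c` with `c ≥ 0`. -/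
def IsDegreeSequence (d : List ℕ) : Prop :=
  d ≠ [] ∧ d.Pairwise (· < ·)

/-- The pure diagram of the degree sequence `d = (d₀ < ⋯ < d_c)`, normalised so that its entry in
column `0` is one.  Its nonzero entries are at the positions `(i, dᵢ)` (column `i`, degree `dᵢ`, so
row `dᵢ - i`), and they are `∏_{l ≠ 0} (d_l - d₀) / ∏_{l ≠ i} |d_l - dᵢ|`. -/
def pureDiagram (d : List ℕ) (i j : ℕ) : ℝ :=
  if d[i]? = some j then
    (d.tail.map fun l => (l : ℝ) - (d.headD 0 : ℝ)).prod /
      ((d.eraseIdx i).map fun l => |(l : ℝ) - (j : ℝ)|).prod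
  else 0

/-- `w` is a decomposition of the diagram `β` into pure diagrams: a finite sum of pure diagrams
with nonnegative real weights. -/
def IsDecomposition (β : ℕ → ℕ → ℕ) (w : List ℕ →₀ ℝ) : Prop :=
  (∀ d ∈ w.support, IsDegreeSequence d) ∧ (∀ d, 0 ≤ w d) ∧
    ∀ i j, (β i j : ℝ) = w.sum fun d c => c * pureDiagram d i j

/-- The polytope of weight vectors `(w₁,…,w_m)` of the decompositions of `β` of the form
`w₁ π₁ + ⋯ + w_m π_m`, where `π_s` is the pure diagram of the degree sequence `D s`. -/
def decompositionPolytope {m : ℕ} (β : ℕ → ℕ → ℕ) (D : Fin m → List ℕ) : Set (Fin m → ℝ) :=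
  {w | (∀ s, 0 ≤ w s) ∧ ∀ i j, (β i j : ℝ) = ∑ s, w s * pureDiagram (D s) i j}

/-- The degree sequences of the eight translated pure diagrams `π₁(k), …, π₈(k)`. -/
def translatedSequence (k : ℕ) : Fin 8 → List ℕ :=
  ![[0, 2 * k, 2 * k + 1, 2 * k + 2],
    [0, 2 * k, 2 * k + 1, 2 * k + 3],
    [0, 2 * k, 2 * k + 2, 2 * k + 3],
    [0, 2 * k, 2 * k + 1, 2 * k + 2, 2 * k + 3],
    [0, 2 * k, 2 * k + 1, 2 * k + 2, 2 * k + 4],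
    [0, 2 * k, 2 * k + 1, 2 * k + 3, 2 * k + 4],
    [0, 2 * k, 2 * k + 2, 2 * k + 3, 2 * k + 4],
    [0, 2 * k, 2 * k + 1, 2 * k + 2, 2 * k + 3, 2 * k + 4]]

/-- The entries of row `2k - 1` of the Betti diagram of `S ⧸ I ^ k`, by column. -/
def pathRow₁ (k : ℕ) : ℕ → ℕ
  | 1 => (k + 4).choose 4
  | 2 => 4 * (k + 3).choose 4
  | 3 => 6 * (k + 2).choose 4
  | 4 => 4 * (k + 1).choose 4
  | 5 => k.choose 4
  | _ => 0

/-- The entries of row `2k` of the Betti diagram of `S ⧸ I ^ k`, by column. -/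
def pathRow₂ (k : ℕ) : ℕ → ℕ
  | 2 => k * (k + 2)
  | 3 => 2 * k * (k + 1)
  | 4 => k ^ 2
  | _ => 0

/-- The Betti diagram of `S ⧸ I ^ k` for `k ≥ 1`: the entry in column `i` and degree `j` stands in
row `j - i`. -/
def pathDiagram (k i j : ℕ) : ℕ :=
  if i = 0 ∧ j = 0 then 1
  else if j + 1 = i + 2 * k then pathRow₁ k i
  else if j = i + 2 * k then pathRow₂ k i
  else 0

/-- The common fourth coordinate of the vertices. -/
def wCoord₄ (k : ℝ) : ℝ :=
  (7 * k + 15) * (k - 1) * (k - 2) / (4 * (2 * k + 3) * (2 * k + 1) * (k + 1))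

/-- The common eighth coordinate of the vertices. -/
def wCoord₈ (k : ℝ) : ℝ :=
  (k - 1) * (k - 2) * (k - 3) / (4 * (2 * k + 3) * (2 * k + 1) * (k + 1))

/-- The first vertex. -/
def hVertex₁ (k : ℝ) : Fin 8 → ℝ :=
  ![0, 0, (k + 2) / (2 * k + 3), wCoord₄ k,
    (2 * k + 5) * (k - 1) / ((2 * k + 1) * (k + 2) * (k + 1)),
    (4 * k + 5) * (k + 1) / ((2 * k + 3) * (2 * k + 1) * (k + 2)), 0, wCoord₈ k]

/-- The second vertex. -/
def hVertex₂ (k : ℝ) : Fin 8 → ℝ :=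
  ![0, 2 * (k + 2) * (k + 1) / ((2 * k + 3) * (2 * k + 1)), 0, wCoord₄ k,
    (2 * k + 5) * (k - 1) / ((2 * k + 1) * (k + 2) * (k + 1)),
    (k + 1) * (k - 1) / ((2 * k + 3) * (2 * k + 1) * (k + 2)), 1 / (2 * k + 3), wCoord₈ k]

/-- The third vertex. -/
def hVertex₃ (k : ℝ) : Fin 8 → ℝ :=
  ![(k + 2) / (2 * k + 1), 0, 0, wCoord₄ k,
    (k ^ 2 - 7) / ((2 * k + 1) * (k + 2) * (k + 1)),
    (k + 1) / ((2 * k + 3) * (k + 2)), 1 / (2 * k + 3), wCoord₈ k]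

end

/-! Number the variables from `0` and write `m_a` for the product of the edges of the path with
exponents `a`. The `m_a` with `∑ a i = k` generate `I ^ k`. They are added in decreasing
lexicographic order of `a`. The colon ideal of the earlier generators by `m_a` depends only on which
of `a 1, …, a 4` are positive (`add_pathExpo_mem_iff`): it is generated by the variable `x_i` for
each positive `a (i + 1)`, together with at most the quadrics `x₀x₁` and `x₁x₂`. These finitely many
ideals have explicit minimal multigraded resolutions (`hasTable_colonTable`), and iterated mapping
cones assemble them into a resolution of `S / I ^ k` (`hasTable_path`). Every cone is minimal
because entries that could cancel never have the same multidegree (`pathColonTable_disjoint`).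
Counting the tuples `a` by their pattern of positive entries gives the Betti numbers over any field,
and `betti_eq` carries them to every minimal resolution.

For the decompositions, nonnegativity prevents cancellation, so only degree sequences inside the
support of the diagram occur: the eight translated ones and four of length at most three. The
alternating sum of the entries weighted by `(j - 2k)²` is zero on `β(S / I ^ k)` and on the eight
long sequences, by the Herzog–Kühl equations in codimension at least three, but positive on the four
short ones. These therefore have weight zero (`support_of_isDecomposition`).

For the polytope, the linear equations cut out a plane. Each of the first three coordinates is
nonzero at exactly one of the `h_i`, so the barycentric coordinates of a solution are positive
multiples of its first three coordinates (`PathWeights.eq_combination`), and their signs already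
place it in the triangle. Conversely the three vertices are nonnegative solutions when `k ≥ 3`. -/

open MvPolynomial

/-! ### Homogeneous components of vectors in graded free modules -/

section Homogeneous

variable {σ R : Type*} [CommRing R]

theorem homogeneousComponent_mul_of_isHomogeneous {p : MvPolynomial σ R} {m : ℕ}
    (hp : p.IsHomogeneous m) (q : MvPolynomial σ R) (n : ℕ) :
    homogeneousComponent n (p * q) =
      if m ≤ n then p * homogeneousComponent (n - m) q else 0 := by
  classical
  let _ := gradedAlgebra (σ := σ) (R := R)
  have h := DirectSum.coe_decompose_mul_of_left_mem (homogeneousSubmodule σ R) (i := m) (b := q) n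
    ((mem_homogeneousSubmodule m p).2 hp)
  have hdec : ∀ (x : MvPolynomial σ R) (i : ℕ),
      (DirectSum.decompose (homogeneousSubmodule σ R) x i : MvPolynomial σ R) =
        homogeneousComponent i x := fun x i => decomposition.decompose'_apply x i
  rwa [hdec, hdec] at h

/-- A vector of polynomials that is homogeneous of degree `j` in a free module whose basis elements
have degrees `δ`. -/
def IsHomogeneousVec {ι : Type*} (δ : ι → ℕ) (j : ℕ) (y : ι → MvPolynomial σ R) : Prop :=
  ∀ a, y a ≠ 0 → ∃ m, j = δ a + m ∧ (y a).IsHomogeneous m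

/-- The component of degree `j` of a vector in a free module with basis elements of degrees `δ`. -/
noncomputable def vecComponent {ι : Type*} (δ : ι → ℕ) (j : ℕ) (y : ι → MvPolynomial σ R) :
    ι → MvPolynomial σ R :=
  fun a => if δ a ≤ j then homogeneousComponent (j - δ a) (y a) else 0

theorem isHomogeneousVec_vecComponent {ι : Type*} (δ : ι → ℕ) (j : ℕ)
    (y : ι → MvPolynomial σ R) : IsHomogeneousVec δ j (vecComponent δ j y) := by
  intro a ha
  unfold vecComponent at ha ⊢
  split_ifs at ha ⊢ with h
  · exact ⟨j - δ a, by omega, homogeneousComponent_isHomogeneous _ _⟩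
  · exact absurd rfl ha

theorem IsHomogeneousVec.vecComponent_eq {ι : Type*} {δ : ι → ℕ} {j : ℕ}
    {y : ι → MvPolynomial σ R} (hy : IsHomogeneousVec δ j y) : vecComponent δ j y = y := by
  funext a
  unfold vecComponent
  by_cases h0 : y a = 0
  · simp [h0]
  · obtain ⟨m, rfl, hm⟩ := hy a h0
    simpa using homogeneousComponent_eq_self hm

/-- Because of this, any preimage of a homogeneous vector can be replaced by its component of the
right degree. -/
theorem vecComponent_mulVec {ι κ : Type*} [Fintype κ] {δ : ι → ℕ} {ε : κ → ℕ}
    {D : Matrix ι κ (MvPolynomial σ R)}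
    (hD : ∀ b, IsHomogeneousVec δ (ε b) (fun a => D a b)) (j : ℕ) (y : κ → MvPolynomial σ R) :
    vecComponent δ j (D.mulVec y) = D.mulVec (vecComponent ε j y) := by
  funext a
  simp only [vecComponent, Matrix.mulVec, dotProduct, map_sum]
  by_cases ha : δ a ≤ j
  · rw [if_pos ha]
    refine Finset.sum_congr rfl fun b _ => ?_
    by_cases h0 : D a b = 0
    · simp [h0]
    · obtain ⟨m, hm, hh⟩ := hD b a h0
      rw [homogeneousComponent_mul_of_isHomogeneous hh, hm]
      by_cases h : m ≤ j - δ a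
      · rw [if_pos h, if_pos (by omega), Nat.sub_sub]
      · rw [if_neg h, if_neg (by omega), mul_zero]
  · rw [if_neg ha]
    refine (Finset.sum_eq_zero fun b _ => ?_).symm
    by_cases h0 : D a b = 0
    · simp [h0]
    · obtain ⟨m, hm, -⟩ := hD b a h0
      rw [if_neg (by omega), mul_zero]

end Homogeneous

/-! ### Uniqueness of the graded Betti numbers -/

namespace MinimalFreeResolution

variable {K : Type*} [Field K] {n : ℕ} {J : Ideal (MvPolynomial (Fin n) K)}

theorem isHomogeneousVec_d (F : MinimalFreeResolution K n J) (i : ℕ) (b : Fin (F.rank (i + 1))) :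
    IsHomogeneousVec (F.deg i) (F.deg (i + 1) b) (fun a => F.d i a b) :=
  fun a h => F.d_homogeneous i a b h

theorem d_mulVec_d (F : MinimalFreeResolution K n J) (i : ℕ)
    (v : Fin (F.rank (i + 2)) → MvPolynomial (Fin n) K) :
    (F.d i).mulVec ((F.d (i + 1)).mulVec v) = 0 :=
  (F.exact_succ i).apply_apply_eq_zero v

theorem exists_of_d_eq_zero (F : MinimalFreeResolution K n J) (i : ℕ)
    {v : Fin (F.rank (i + 1)) → MvPolynomial (Fin n) K} (hv : (F.d i).mulVec v = 0) :
    ∃ w, (F.d (i + 1)).mulVec w = v :=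
  (F.exact_succ i v).1 hv

/-- A homogeneous boundary has a homogeneous preimage. -/
theorem exists_homogeneous_preimage (F : MinimalFreeResolution K n J) (i j : ℕ)
    {y : Fin (F.rank i) → MvPolynomial (Fin n) K} (hy : IsHomogeneousVec (F.deg i) j y)
    (h : ∃ w, (F.d i).mulVec w = y) :
    ∃ w, IsHomogeneousVec (F.deg (i + 1)) j w ∧ (F.d i).mulVec w = y := by
  obtain ⟨w, rfl⟩ := h
  refine ⟨vecComponent (F.deg (i + 1)) j w, isHomogeneousVec_vecComponent _ _ _, ?_⟩
  rw [← vecComponent_mulVec (F.isHomogeneousVec_d i), hy.vecComponent_eq]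

/-- The augmentation is given by a row of homogeneous polynomials. -/
theorem exists_aug_row (F : MinimalFreeResolution K n J) :
    ∃ q : Matrix Unit (Fin (F.rank 0)) (MvPolynomial (Fin n) K),
      (∀ b, IsHomogeneousVec (fun _ => 0) (F.deg 0 b) (fun a => q a b)) ∧
      ∀ v, F.aug v = Ideal.Quotient.mk J (q.mulVec v ()) := by
  choose q hq haug using F.aug_homogeneous
  refine ⟨fun _ b => q b, fun b _ _ => ⟨F.deg 0 b, by simp, hq b⟩, fun v => ?_⟩
  have hv : v = ∑ b, v b • Pi.single b (1 : MvPolynomial (Fin n) K) := by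
    funext a
    simp [Finset.sum_apply, Pi.single_apply]
  conv_lhs => rw [hv]
  simp only [map_sum, map_smul, haug, Matrix.mulVec, dotProduct]
  refine Finset.sum_congr rfl fun b _ => ?_
  rw [mul_comm, map_mul]
  rfl

theorem exists_homogeneous_aug_preimage (F : MinimalFreeResolution K n J)
    (hJ : ∀ p ∈ J, ∀ m, homogeneousComponent m p ∈ J) {p : MvPolynomial (Fin n) K} {j : ℕ}
    (hp : p.IsHomogeneous j) :
    ∃ w, IsHomogeneousVec (F.deg 0) j w ∧ F.aug w = Ideal.Quotient.mk J p := by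
  obtain ⟨q, hq, haug⟩ := F.exists_aug_row
  obtain ⟨w, hw⟩ := F.aug_surjective (Ideal.Quotient.mk J p)
  refine ⟨vecComponent (F.deg 0) j w, isHomogeneousVec_vecComponent _ _ _, ?_⟩
  rw [haug, Ideal.Quotient.eq] at hw ⊢
  rw [← vecComponent_mulVec hq]
  have h := hJ _ hw j
  rw [map_sub, homogeneousComponent_eq_self hp] at h
  simpa [vecComponent] using h

/-- A matrix `F i → G i` that preserves degrees. -/
def IsGradedMatrix (F G : MinimalFreeResolution K n J) (i : ℕ)
    (Φ : Matrix (Fin (G.rank i)) (Fin (F.rank i)) (MvPolynomial (Fin n) K)) : Prop :=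
  ∀ b, IsHomogeneousVec (G.deg i) (F.deg i b) (fun a => Φ a b)

theorem isHomogeneousVec_mulVec {ι κ : Type*} [Fintype κ] {δ : ι → ℕ} {ε : κ → ℕ}
    {D : Matrix ι κ (MvPolynomial (Fin n) K)}
    (hD : ∀ b, IsHomogeneousVec δ (ε b) (fun a => D a b)) {j : ℕ}
    {y : κ → MvPolynomial (Fin n) K} (hy : IsHomogeneousVec ε j y) :
    IsHomogeneousVec δ j (D.mulVec y) := by
  rw [← hy.vecComponent_eq, ← vecComponent_mulVec hD]
  exact isHomogeneousVec_vecComponent _ _ _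

theorem exists_comparison_zero (F G : MinimalFreeResolution K n J)
    (hJ : ∀ p ∈ J, ∀ m, homogeneousComponent m p ∈ J) :
    ∃ Φ, IsGradedMatrix F G 0 Φ ∧ ∀ v, G.aug (Φ.mulVec v) = F.aug v := by
  choose q hq haug using F.aug_homogeneous
  choose w hw hGw using fun b => G.exists_homogeneous_aug_preimage hJ (hq b)
  refine ⟨Matrix.of fun a b => w b a, hw, fun v => ?_⟩
  suffices h : G.aug ∘ₗ (Matrix.of fun a b => w b a).mulVecLin = F.aug from LinearMap.congr_fun h v
  refine LinearMap.pi_ext' fun b => LinearMap.ext_ring ?_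
  simp only [LinearMap.comp_apply, LinearMap.single_apply, Matrix.mulVecLin_apply,
    Matrix.mulVec_single_one, haug]
  exact hGw b

theorem exists_comparison_succ (F G : MinimalFreeResolution K n J) (i : ℕ)
    {Φ : Matrix (Fin (G.rank i)) (Fin (F.rank i)) (MvPolynomial (Fin n) K)}
    (hΦ : IsGradedMatrix F G i Φ)
    (h : ∀ v, ∃ w, (G.d i).mulVec w = Φ.mulVec ((F.d i).mulVec v)) :
    ∃ Ψ, IsGradedMatrix F G (i + 1) Ψ ∧ G.d i * Ψ = Φ * F.d i := by
  have key : ∀ b, ∃ w, IsHomogeneousVec (G.deg (i + 1)) (F.deg (i + 1) b) w ∧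
      (G.d i).mulVec w = Φ.mulVec (fun a => F.d i a b) := by
    intro b
    refine G.exists_homogeneous_preimage i _
      (isHomogeneousVec_mulVec hΦ (F.isHomogeneousVec_d i b)) ?_
    obtain ⟨w, hw⟩ := h (Pi.single b 1)
    exact ⟨w, by rw [hw, Matrix.mulVec_single_one]; rfl⟩
  choose w hw hGw using key
  refine ⟨fun a b => w b a, hw, ?_⟩
  ext1 a b
  exact congrFun (hGw b) a

/-- Every two resolutions are linked by a chain map over the identity that preserves degrees. -/
theorem exists_comparison (F G : MinimalFreeResolution K n J)
    (hJ : ∀ p ∈ J, ∀ m, homogeneousComponent m p ∈ J) :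
    ∃ Φ : ∀ i, Matrix (Fin (G.rank i)) (Fin (F.rank i)) (MvPolynomial (Fin n) K),
      (∀ i, IsGradedMatrix F G i (Φ i)) ∧ (∀ v, G.aug ((Φ 0).mulVec v) = F.aug v) ∧
      ∀ i, G.d i * Φ (i + 1) = Φ i * F.d i := by
  -- The second clause is what the next lift needs. Carrying it in the predicate treats degree zero,
  -- where exactness involves the augmentation, uniformly with the higher degrees.
  let P : ∀ i, Matrix (Fin (G.rank i)) (Fin (F.rank i)) (MvPolynomial (Fin n) K) → Prop :=
    fun i Φ => IsGradedMatrix F G i Φ ∧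
      ∀ v, ∃ w, (G.d i).mulVec w = Φ.mulVec ((F.d i).mulVec v)
  obtain ⟨Φ₀, hΦ₀, haug⟩ := exists_comparison_zero F G hJ
  have h₀ : P 0 Φ₀ := by
    refine ⟨hΦ₀, fun v => (G.exact_zero _).1 ?_⟩
    rw [haug]
    exact F.exact_zero.apply_apply_eq_zero v
  have step : ∀ i Φ, P i Φ → ∃ Ψ, P (i + 1) Ψ ∧ G.d i * Ψ = Φ * F.d i := by
    rintro i Φ ⟨hΦ, h⟩
    obtain ⟨Ψ, hΨ, hc⟩ := exists_comparison_succ F G i hΦ h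
    refine ⟨Ψ, ⟨hΨ, fun v => G.exists_of_d_eq_zero i ?_⟩, hc⟩
    rw [Matrix.mulVec_mulVec, hc, ← Matrix.mulVec_mulVec, F.d_mulVec_d, Matrix.mulVec_zero]
  choose next hnext hcomm using step
  let Φ : ∀ i, {Φ // P i Φ} := fun i =>
    Nat.rec ⟨Φ₀, h₀⟩ (fun i Φ => ⟨next i Φ.1 Φ.2, hnext i Φ.1 Φ.2⟩) i
  exact ⟨fun i => (Φ i).1, fun i => (Φ i).2.1, haug, fun i => hcomm i (Φ i).1 (Φ i).2⟩

/-- A chain map from a minimal resolution to itself over zero has entries without constant terms. -/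
theorem constantCoeff_eq_zero_of_lift_zero (F : MinimalFreeResolution K n J)
    (Θ : ∀ i, Matrix (Fin (F.rank i)) (Fin (F.rank i)) (MvPolynomial (Fin n) K))
    (haug : ∀ v, F.aug ((Θ 0).mulVec v) = 0) (hΘ : ∀ i, F.d i * Θ (i + 1) = Θ i * F.d i)
    (i : ℕ) (a b : Fin (F.rank i)) : constantCoeff (Θ i a b) = 0 := by
  have lift_cols : ∀ (i : ℕ) {m : ℕ} (A : Matrix (Fin (F.rank (i + 1))) (Fin m)
      (MvPolynomial (Fin n) K)), F.d i * A = 0 → 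
      ∃ h : Matrix _ (Fin m) _, A = F.d (i + 1) * h := by
    intro i m A hA
    have : ∀ b, ∃ w, (F.d (i + 1)).mulVec w = fun a => A a b := fun b =>
      F.exists_of_d_eq_zero i (by funext a; exact congrFun (congrFun hA a) b)
    choose w hw using this
    exact ⟨fun a b => w b a, by ext1 a b; exact (congrFun (hw b) a).symm⟩
  have dd : ∀ i, F.d i * F.d (i + 1) = 0 := by
    intro i
    ext1 a b
    have := congrFun (F.d_mulVec_d i (Pi.single b 1)) a
    rwa [Matrix.mulVec_mulVec, Matrix.mulVec_single_one] at this
  have cd : ∀ (i : ℕ) {m : ℕ} (h : Matrix (Fin (F.rank (i + 1))) (Fin m)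
      (MvPolynomial (Fin n) K)) (a b),
      constantCoeff ((F.d i * h) a b) = 0 := by
    intro i m h a b
    simp [Matrix.mul_apply, F.minimal]
  have dc : ∀ (i : ℕ) {m : ℕ} (h : Matrix (Fin m) (Fin (F.rank i))
      (MvPolynomial (Fin n) K)) (a b),
      constantCoeff ((h * F.d i) a b) = 0 := by
    intro i m h a b
    simp [Matrix.mul_apply, F.minimal]
  -- A null homotopy is built along the induction: `Θ (i + 1) = d h' + h d`, and both summands have
  -- entries without constant term by minimality. Only the identity that allows the next lift is
  -- kept about `h`.
  suffices H : ∀ i, (∃ h : Matrix (Fin (F.rank (i + 1))) (Fin (F.rank i))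
      (MvPolynomial (Fin n) K), (Θ i - F.d i * h) * F.d i = 0) ∧
      ∀ a b, constantCoeff (Θ i a b) = 0 from (H i).2 a b
  intro i
  induction i with
  | zero =>
    have : ∀ b, ∃ w, (F.d 0).mulVec w = fun a => Θ 0 a b := by
      intro b
      refine (F.exact_zero _).1 ?_
      have := haug (Pi.single b 1)
      rwa [Matrix.mulVec_single_one] at this
    choose w hw using this
    have h0 : Θ 0 = F.d 0 * Matrix.of (fun a b => w b a) := by
      ext1 a b
      exact (congrFun (hw b) a).symm
    refine ⟨⟨Matrix.of fun a b => w b a, ?_⟩, fun a b => ?_⟩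
    · rw [← h0, sub_self, Matrix.zero_mul]
    · rw [h0]
      exact cd 0 _ a b
  | succ i ih =>
    obtain ⟨⟨h, hh⟩, -⟩ := ih
    obtain ⟨h', hh'⟩ := lift_cols i (Θ (i + 1) - h * F.d i) (by
      rw [Matrix.mul_sub, hΘ, ← Matrix.mul_assoc, ← Matrix.sub_mul, hh])
    have hs : Θ (i + 1) = F.d (i + 1) * h' + h * F.d i :=
      sub_eq_iff_eq_add.1 hh'
    refine ⟨⟨h', ?_⟩, fun a b => ?_⟩
    · rw [hs, add_sub_cancel_left, Matrix.mul_assoc, dd, Matrix.mul_zero]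
    · rw [hs, Matrix.add_apply, map_add, cd, dc, add_zero]

/-- The composite of comparison maps is the identity modulo the variables, by minimality. Constant
terms occur only between basis elements of equal degree, so the degree `j` block of one map is
injective over `K`. -/
theorem betti_le (F G : MinimalFreeResolution K n J)
    (hJ : ∀ p ∈ J, ∀ m, homogeneousComponent m p ∈ J) (i j : ℕ) :
    F.betti i j ≤ G.betti i j := by
  obtain ⟨Φ, hΦ, hΦaug, hΦd⟩ := exists_comparison F G hJ
  obtain ⟨Ψ, -, hΨaug, hΨd⟩ := exists_comparison G F hJ
  have hone := F.constantCoeff_eq_zero_of_lift_zero (fun i => Ψ i * Φ i - 1)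
    (fun v => by
      rw [Matrix.sub_mulVec, map_sub, ← Matrix.mulVec_mulVec, hΨaug, hΦaug, Matrix.one_mulVec,
        sub_self])
    (fun i => by
      rw [Matrix.mul_sub, Matrix.sub_mul, ← Matrix.mul_assoc, hΨd, Matrix.mul_assoc, hΦd,
        Matrix.mul_assoc, Matrix.mul_one, Matrix.one_mul])
    i
  have hdeg : ∀ a b, constantCoeff (Φ i a b) ≠ 0 → G.deg i a = F.deg i b := by
    intro a b hab
    have h0 : Φ i a b ≠ 0 := fun h => hab (by rw [h, map_zero])
    obtain ⟨m, hm, hh⟩ := hΦ i b a h0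
    have : m = 0 := by
      by_contra hm0
      exact hab (hh.coeff_eq_zero (by simpa using Ne.symm hm0))
    omega
  let A : Matrix {a // F.deg i a = j} {b // G.deg i b = j} K :=
    Matrix.of fun a b => constantCoeff (Ψ i a b)
  let B : Matrix {b // G.deg i b = j} {a // F.deg i a = j} K :=
    Matrix.of fun b a => constantCoeff (Φ i b a)
  have hAB : A * B = 1 := by
    ext1 a b
    have h := hone a b
    rw [Matrix.sub_apply, map_sub, sub_eq_zero, Matrix.mul_apply, map_sum] at h
    have h1 : constantCoeff ((1 : Matrix (Fin (F.rank i)) (Fin (F.rank i))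
        (MvPolynomial (Fin n) K)) a b) = (1 : Matrix _ _ K) a b := by
      rw [Matrix.one_apply, Matrix.one_apply]
      simp only [Subtype.ext_iff]
      split_ifs <;> simp
    rw [← h1, ← h, Matrix.mul_apply]
    simp only [A, B, map_mul, Matrix.of_apply]
    rw [← Finset.sum_subtype (Finset.univ.filter fun c => G.deg i c = j) (by simp)
      (fun c => constantCoeff (Ψ i a c) * constantCoeff (Φ i c b))]
    refine Finset.sum_subset (Finset.subset_univ _) fun c _ hc => ?_
    by_contra hne
    exact hc (by simpa using (hdeg c b (right_ne_zero_of_mul hne)).trans b.2)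
  have hinj : Function.Injective B.mulVecLin := by
    intro x y hxy
    have := congrArg A.mulVec hxy
    simpa [Matrix.mulVec_mulVec, hAB] using this
  simpa only [betti, Fintype.card_subtype] using card_le_of_injective K B.mulVecLin hinj

/-- The graded Betti numbers do not depend on the minimal resolution. -/
theorem betti_eq (F G : MinimalFreeResolution K n J)
    (hJ : ∀ p ∈ J, ∀ m, homogeneousComponent m p ∈ J) (i j : ℕ) :
    F.betti i j = G.betti i j :=
  le_antisymm (betti_le F G hJ i j) (betti_le G F hJ i j)

end MinimalFreeResolution

/-! ### Multigraded resolutions and mapping cones -/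

/-- A minimal free resolution of the quotient by a monomial ideal, graded by exponent vectors.  The
ideal is given by the set `J` of exponents of its monomials.  The matrix of the differential from
`b` to `a` is `c a b` times the monomial of exponent `deg b - deg a`, so that the piece of degree
`α` of the resolution is the complex of vector spaces on the basis elements of degree `≤ α`. -/
structure MonomialResolution (K : Type*) [Field K] (n : ℕ) (J : Set (Fin n → ℕ)) where
  /-- the basis elements of all the free modules -/
  B : Type
  [fintype : Fintype B]
  /-- the homological degree -/
  hom : B → ℕ
  /-- the exponent vector of a basis element -/
  deg : B → Fin n → ℕ
  /-- the only basis element of homological degree zero -/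
  base : B
  /-- the coefficients of the differential -/
  c : Matrix B B K
  hom_eq_zero : ∀ b, hom b = 0 ↔ b = base
  deg_base : deg base = 0
  hom_of_c : ∀ a b, c a b ≠ 0 → hom b = hom a + 1
  deg_lt_of_c : ∀ a b, c a b ≠ 0 → deg a < deg b
  c_mul_c : c * c = 0
  -- In degree `α` the quotient is `K` if `α ∉ J` and zero if `α ∈ J`. The coordinate at `base` is
  -- the part of homological degree zero, so this field and the next express exactness of the
  -- augmented strand, in all homological degrees at once.
  mem_of_ne_zero : ∀ (α : Fin n → ℕ) (v : B → K), (∀ b, v b ≠ 0 → deg b ≤ α) →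
    c.mulVec v base ≠ 0 → α ∈ J
  exact : ∀ (α : Fin n → ℕ) (v : B → K), (∀ b, v b ≠ 0 → deg b ≤ α) → c.mulVec v = 0 →
    (v base ≠ 0 → α ∈ J) → ∃ w : B → K, (∀ b, w b ≠ 0 → deg b ≤ α) ∧ c.mulVec w = v

namespace MonomialResolution

variable {K : Type*} [Field K] {n : ℕ} {J J₁ : Set (Fin n → ℕ)}

attribute [instance] MonomialResolution.fintype

/-- The homological degrees and exponent vectors of the basis elements. -/
def table (F : MonomialResolution K n J) : Multiset (ℕ × (Fin n → ℕ)) :=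
  Finset.univ.val.map fun b => (F.hom b, F.deg b)

theorem mem_table (F : MonomialResolution K n J) (b : F.B) : (F.hom b, F.deg b) ∈ F.table :=
  Multiset.mem_map_of_mem _ (Finset.mem_univ b)

theorem hom_base (F : MonomialResolution K n J) : F.hom F.base = 0 := (F.hom_eq_zero _).2 rfl

theorem c_base (F : MonomialResolution K n J) (a : F.B) : F.c a F.base = 0 := by
  by_contra h
  have := F.hom_of_c _ _ h
  rw [F.hom_base] at this
  omega

theorem mulVec_mulVec (F : MonomialResolution K n J) (v : F.B → K) :
    F.c.mulVec (F.c.mulVec v) = 0 := by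
  rw [Matrix.mulVec_mulVec, F.c_mul_c, Matrix.zero_mulVec]

/-- The resolution of the ring itself. -/
def unit (K : Type*) [Field K] (n : ℕ) : MonomialResolution K n ∅ where
  B := Unit
  hom _ := 0
  deg _ := 0
  base := ()
  c := 0
  hom_eq_zero := by simp
  deg_base := rfl
  hom_of_c := by simp
  deg_lt_of_c := by simp
  c_mul_c := by simp
  mem_of_ne_zero := by simp
  exact α v hv _ h0 := by
    refine ⟨0, by simp, ?_⟩
    funext b
    by_contra h
    exact h0 (by simpa using Ne.symm h)

/-- The condition on the images of the basis elements of homological degree at most `m` under a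
chain map over the multiplication by the monomial of exponent `f`. -/
def IsPartialLift (F : MonomialResolution K n J) (G : MonomialResolution K n J₁) (f : Fin n → ℕ)
    (m : ℕ) (φ : Matrix F.B G.B K) : Prop :=
  (∀ a b, φ a b ≠ 0 → F.hom a = G.hom b ∧ F.deg a ≤ G.deg b + f) ∧
    φ F.base G.base = 1 ∧
    ∀ b, G.hom b ≤ m → ∀ a, (F.c * φ) a b = (φ * G.c) a b

/-- A boundary in one homological degree has a preimage in one homological degree. -/
theorem exists_preimage_hom (F : MonomialResolution K n J) (α : Fin n → ℕ) (m : ℕ) {v : F.B → K}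
    (hm : ∀ b, v b ≠ 0 → F.hom b = m) (hv : ∀ b, v b ≠ 0 → F.deg b ≤ α)
    (h0 : F.c.mulVec v = 0) (hb : v F.base ≠ 0 → α ∈ J) :
    ∃ w : F.B → K, (∀ b, w b ≠ 0 → F.hom b = m + 1 ∧ F.deg b ≤ α) ∧ F.c.mulVec w = v := by
  obtain ⟨w, hw, rfl⟩ := F.exact α v hv h0 hb
  refine ⟨fun b => if F.hom b = m + 1 then w b else 0, fun b hb => ?_, ?_⟩
  · simp only [ne_eq, ite_eq_right_iff, Classical.not_imp] at hb
    exact ⟨hb.1, hw b hb.2⟩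
  · funext a
    by_cases ha : F.hom a = m
    · refine Finset.sum_congr rfl fun b _ => ?_
      by_cases hc : F.c a b = 0
      · simp [hc]
      · simp only [F.hom_of_c _ _ hc, ha, if_true]
    · rw [not_imp_comm.1 (hm a) ha]
      refine Finset.sum_eq_zero fun b _ => ?_
      by_cases hc : F.c a b = 0
      · simp [hc]
      · have := F.hom_of_c _ _ hc
        dsimp only
        rw [if_neg (by omega), mul_zero]

/-- The lift is made one homological degree at a time; the image of `b` is found in the single
strand of degree `G.deg b + f`. -/
theorem exists_isPartialLift (F : MonomialResolution K n J) (G : MonomialResolution K n J₁)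
    (f : Fin n → ℕ) (hJ : ∀ γ ∈ J₁, γ + f ∈ J) (m : ℕ) :
    ∃ φ : Matrix F.B G.B K, IsPartialLift F G f m φ := by
  classical
  induction m with
  | zero =>
    refine ⟨Matrix.of fun a b => if a = F.base ∧ b = G.base then 1 else 0, ?_, by simp, ?_⟩
    · intro a b h
      have h' : a = F.base ∧ b = G.base := by
        by_contra hn
        exact h (by simp [hn])
      obtain ⟨rfl, rfl⟩ := h'
      simp [hom_base, deg_base]
    · intro b hb a
      obtain rfl := (G.hom_eq_zero b).1 (by omega)
      simp [Matrix.mul_apply, c_base, Finset.sum_ite_eq', F.c_base, ite_and]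
  | succ m ih =>
    obtain ⟨φ, hφ, hbase, hcomm⟩ := ih
    have key : ∀ b, G.hom b = m + 1 → ∃ w : F.B → K,
        (∀ a, w a ≠ 0 → F.hom a = m + 1 ∧ F.deg a ≤ G.deg b + f) ∧
          F.c.mulVec w = fun a => (φ * G.c) a b := by
      intro b hb
      refine F.exists_preimage_hom (G.deg b + f) m ?_ ?_ ?_ ?_
      · intro a ha
        obtain ⟨e, -, he⟩ := Finset.exists_ne_zero_of_sum_ne_zero ha
        have h1 := (hφ a e (left_ne_zero_of_mul he)).1
        have h2 := G.hom_of_c e b (right_ne_zero_of_mul he)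
        omega
      · intro a ha
        obtain ⟨e, -, he⟩ := Finset.exists_ne_zero_of_sum_ne_zero ha
        exact (hφ a e (left_ne_zero_of_mul he)).2.trans
          (add_le_add_left (G.deg_lt_of_c e b (right_ne_zero_of_mul he)).le f)
      · have h2 : F.c * (φ * G.c) = F.c * φ * G.c := (Matrix.mul_assoc _ _ _).symm
        funext a
        have : (F.c * (φ * G.c)) a b = (φ * (G.c * G.c)) a b := by
          rw [h2, ← Matrix.mul_assoc, Matrix.mul_apply, Matrix.mul_apply]
          refine Finset.sum_congr rfl fun e _ => ?_
          by_cases hc : G.c e b = 0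
          · simp [hc]
          · rw [hcomm e (by have := G.hom_of_c e b hc; omega)]
        rw [G.c_mul_c, Matrix.mul_zero] at this
        exact this
      -- A nonzero coefficient at the base comes from a nonzero base coefficient in the boundary of
      -- `b`, which puts `G.deg b` in `J₁`.
      · intro h
        refine hJ _ (G.mem_of_ne_zero (G.deg b) (Pi.single b 1) ?_ ?_)
        · intro e he
          have : e = b := by
            by_contra hn
            exact he (by simp [hn])
          rw [this]
        · rw [Matrix.mulVec_single_one]
          obtain ⟨e, -, he⟩ := Finset.exists_ne_zero_of_sum_ne_zero h
          have h1 := (hφ _ e (left_ne_zero_of_mul he)).1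
          rw [F.hom_base] at h1
          obtain rfl := (G.hom_eq_zero e).1 h1.symm
          exact right_ne_zero_of_mul he
    choose! w hw hcw using key
    refine ⟨Matrix.of fun a b => if G.hom b = m + 1 then w b a else φ a b, ?_, ?_, ?_⟩
    · intro a b hab
      rw [Matrix.of_apply] at hab
      split_ifs at hab with h
      · rw [h]
        exact hw b h a hab
      · exact hφ a b hab
    · rw [Matrix.of_apply, if_neg (by rw [G.hom_base]; omega), hbase]
    · intro b hb a
      have hR : ((Matrix.of fun a b => if G.hom b = m + 1 then w b a else φ a b) * G.c) a b =
          (φ * G.c) a b := by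
        rw [Matrix.mul_apply, Matrix.mul_apply]
        refine Finset.sum_congr rfl fun e _ => ?_
        by_cases hc : G.c e b = 0
        · simp [hc]
        · have := G.hom_of_c e b hc
          rw [Matrix.of_apply, if_neg (by omega)]
      rw [hR]
      by_cases h : G.hom b = m + 1
      · rw [← congrFun (hcw b h) a, Matrix.mul_apply, Matrix.mulVec, dotProduct]
        refine Finset.sum_congr rfl fun e _ => ?_
        rw [Matrix.of_apply, if_pos h]
      · rw [← hcomm b (by omega) a, Matrix.mul_apply, Matrix.mul_apply]
        refine Finset.sum_congr rfl fun e _ => ?_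
        rw [Matrix.of_apply, if_neg h]

/-- The multiplication by the monomial of exponent `f` lifts to a chain map. -/
theorem exists_lift (F : MonomialResolution K n J) (G : MonomialResolution K n J₁)
    (f : Fin n → ℕ) (hJ : ∀ γ ∈ J₁, γ + f ∈ J) :
    ∃ φ : Matrix F.B G.B K,
      (∀ a b, φ a b ≠ 0 → F.hom a = G.hom b ∧ F.deg a ≤ G.deg b + f) ∧
        φ F.base G.base = 1 ∧ F.c * φ = φ * G.c := by
  obtain ⟨φ, h1, h2, h3⟩ := exists_isPartialLift F G f hJ (Finset.univ.sup G.hom)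
  exact ⟨φ, h1, h2, by ext1 a b; exact h3 b (Finset.le_sup (Finset.mem_univ b)) a⟩

/-- The mapping cone of the multiplication by the monomial of exponent `f`. -/
def cone (F : MonomialResolution K n J) (G : MonomialResolution K n J₁) (f : Fin n → ℕ)
    (hJ : ∀ γ, γ ∈ J₁ ↔ γ + f ∈ J) (φ : Matrix F.B G.B K)
    (hφ : ∀ a b, φ a b ≠ 0 → F.hom a = G.hom b ∧ F.deg a ≤ G.deg b + f)
    (hbase : φ F.base G.base = 1) (hcomm : F.c * φ = φ * G.c)
    (hne : ∀ a b, F.hom a = G.hom b → F.deg a ≠ G.deg b + f) :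
    MonomialResolution K n {γ | γ ∈ J ∨ f ≤ γ} where
  B := F.B ⊕ G.B
  hom := Sum.elim F.hom (fun b => G.hom b + 1)
  deg := Sum.elim F.deg (fun b => G.deg b + f)
  base := Sum.inl F.base
  c := Matrix.fromBlocks F.c φ 0 (-G.c)
  hom_eq_zero := by
    rintro (a | b)
    · simp [F.hom_eq_zero]
    · simp
  deg_base := F.deg_base
  hom_of_c := by
    rintro (a | a) (b | b) h
    · exact F.hom_of_c a b h
    · simp [(hφ a b h).1]
    · simp at h
    · simp only [Matrix.fromBlocks_apply₂₂, Matrix.neg_apply, ne_eq, neg_eq_zero] at h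
      simp [G.hom_of_c a b h]
  deg_lt_of_c := by
    rintro (a | a) (b | b) h
    · exact F.deg_lt_of_c a b h
    · exact lt_of_le_of_ne (hφ a b h).2 (hne a b (hφ a b h).1)
    · simp at h
    · simp only [Matrix.fromBlocks_apply₂₂, Matrix.neg_apply, ne_eq, neg_eq_zero] at h
      exact add_lt_add_left (G.deg_lt_of_c a b h) f
  c_mul_c := by
    rw [Matrix.fromBlocks_multiply]
    simp [F.c_mul_c, G.c_mul_c, hcomm]
  mem_of_ne_zero := by
    intro α v hv h
    by_cases hf : f ≤ α
    · exact Or.inr hf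
    · left
      refine F.mem_of_ne_zero α (fun a => v (Sum.inl a)) (fun b hb => hv _ hb) ?_
      have h0 : ∀ b, v (Sum.inr b) = 0 := by
        intro b
        by_contra hb
        exact hf (le_trans le_add_self (hv _ hb))
      intro h'
      apply h
      rw [Matrix.fromBlocks_mulVec]
      have hz : v ∘ Sum.inr = 0 := funext h0
      rw [hz]
      simpa [Function.comp_def] using h'
  exact := by
    classical
    intro α v hv h0 hb
    obtain ⟨x, hx⟩ : ∃ x : F.B → K, x = v ∘ Sum.inl := ⟨_, rfl⟩
    obtain ⟨y, hy⟩ : ∃ y : G.B → K, y = v ∘ Sum.inr := ⟨_, rfl⟩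
    have hvxy : v = Sum.elim x y := by rw [hx, hy, Sum.elim_comp_inl_inr]
    subst hvxy
    have hxs : ∀ b, x b ≠ 0 → F.deg b ≤ α := fun b h => hv (Sum.inl b) h
    have hys : ∀ b, y b ≠ 0 → G.deg b + f ≤ α := fun b h => hv (Sum.inr b) h
    rw [Matrix.fromBlocks_mulVec] at h0
    have h1 : F.c.mulVec x + φ.mulVec y = 0 := funext fun a => congrFun h0 (Sum.inl a)
    have h2 : G.c.mulVec y = 0 := by
      funext a
      simpa [Matrix.neg_mulVec] using congrFun h0 (Sum.inr a)
    have supp_φ : ∀ (β : Fin n → ℕ) (u : G.B → K), (∀ b, u b ≠ 0 → G.deg b ≤ β) →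
        ∀ a, φ.mulVec u a ≠ 0 → F.deg a ≤ β + f := by
      intro β u hu a ha
      obtain ⟨e, -, he⟩ := Finset.exists_ne_zero_of_sum_ne_zero ha
      exact (hφ a e (left_ne_zero_of_mul he)).2.trans
        (add_le_add_left (hu e (right_ne_zero_of_mul he)) f)
    have base_φ : ∀ u : G.B → K, φ.mulVec u F.base = u G.base := by
      intro u
      refine (Finset.sum_eq_single G.base (fun e _ he => ?_) (by simp)).trans (by simp [hbase])
      by_contra hne
      have := (hφ _ e (left_ne_zero_of_mul hne)).1
      rw [F.hom_base] at this
      exact he ((G.hom_eq_zero e).1 this.symm)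
    by_cases hf : f ≤ α
    · obtain ⟨β, rfl⟩ : ∃ β, α = β + f := ⟨α - f, (tsub_add_cancel_of_le hf).symm⟩
      have hys' : ∀ b, y b ≠ 0 → G.deg b ≤ β := fun b h => le_of_add_le_add_right (hys b h)
      -- At the base the cycle condition reads `(F.c x) base + y base = 0`; thus `y base ≠ 0` forces
      -- `β + f ∈ J`, that is `β ∈ J₁`.
      obtain ⟨u, hu, hcu⟩ := G.exact β y hys' h2 (by
        intro hyb
        rw [hJ]
        refine F.mem_of_ne_zero _ x hxs fun hz => hyb ?_
        have := congrFun h1 F.base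
        rw [Pi.add_apply, hz, base_φ] at this
        simpa using this)
      -- The base element of `G` is a cycle, so `u` may be altered by a multiple of it. As `φ` sends
      -- base to base with coefficient one, this `t` kills the base coefficient of `x + φ u'`
      -- whenever `F.exact` requires it to vanish.
      set t : K := if β + f ∈ J then 0 else - (x F.base + u G.base) with ht
      set u' : G.B → K := u + Pi.single G.base t with hu'
      have hcu' : G.c.mulVec u' = y := by
        rw [hu', Matrix.mulVec_add, hcu]
        funext a
        simp [G.c_base]
      have hus : ∀ b, u' b ≠ 0 → G.deg b ≤ β := by
        intro b hb
        by_cases h : b = G.base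
        · rw [h, G.deg_base]
          exact zero_le
        · exact hu b (by simpa [hu', h] using hb)
      obtain ⟨z, hz, hcz⟩ := F.exact (β + f) (x + φ.mulVec u') (by
          intro a ha
          by_cases hxa : x a = 0
          · exact supp_φ β u' hus a (by simpa [hxa] using ha)
          · exact hxs a hxa)
        (by
          rw [Matrix.mulVec_add, Matrix.mulVec_mulVec, hcomm, ← Matrix.mulVec_mulVec, hcu', h1])
        (by
          intro h
          by_contra hmem
          apply h
          rw [Pi.add_apply, base_φ, hu', Pi.add_apply, Pi.single_eq_same, ht, if_neg hmem]
          ring)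
      refine ⟨Sum.elim z (-u'), ?_, ?_⟩
      · rintro (b | b) hb
        · exact hz b hb
        · exact add_le_add_left (hus b (by simpa using hb)) f
      · rw [Matrix.fromBlocks_mulVec]
        simp only [Sum.elim_comp_inl, Sum.elim_comp_inr, Matrix.mulVec_neg, Matrix.neg_mulVec,
          Matrix.zero_mulVec, hcz, hcu', neg_neg, zero_add, add_neg_cancel_right]
    · have hy0 : y = 0 := by
        funext b
        by_contra hb
        exact hf (le_trans le_add_self (hys b hb))
      subst hy0
      obtain ⟨z, hz, hcz⟩ := F.exact α x hxs (by simpa using h1)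
        (fun h => (hb h).resolve_right hf)
      refine ⟨Sum.elim z 0, ?_, ?_⟩
      · rintro (b | b) hb
        · exact hz b hb
        · simp at hb
      · rw [Matrix.fromBlocks_mulVec]
        simp [hcz]

end MonomialResolution

/-- The shift of a table by a monomial of exponent `f` and by one homological degree. -/
def shiftEntry {n : ℕ} (f : Fin n → ℕ) (q : ℕ × (Fin n → ℕ)) : ℕ × (Fin n → ℕ) :=
  (q.1 + 1, q.2 + f)

/-- The quotient by the monomial ideal with the set `J` of exponents has a minimal free resolution
whose basis elements are listed by `M`. -/
def HasTable (K : Type*) [Field K] {n : ℕ} (J : Set (Fin n → ℕ))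
    (M : Multiset (ℕ × (Fin n → ℕ))) : Prop :=
  ∃ F : MonomialResolution K n J, F.table = M

theorem hasTable_empty (K : Type*) [Field K] (n : ℕ) :
    HasTable K (∅ : Set (Fin n → ℕ)) {(0, 0)} :=
  ⟨MonomialResolution.unit K n, rfl⟩

theorem HasTable.cone {K : Type*} [Field K] {n : ℕ} {J J₁ : Set (Fin n → ℕ)}
    {M N : Multiset (ℕ × (Fin n → ℕ))} (hM : HasTable K J M) (hN : HasTable K J₁ N)
    (f : Fin n → ℕ) (hJ : ∀ γ, γ ∈ J₁ ↔ γ + f ∈ J)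
    (hdisj : ∀ p ∈ M, ∀ q ∈ N, p.1 = q.1 → p.2 ≠ q.2 + f) :
    HasTable K {γ | γ ∈ J ∨ f ≤ γ} (M + N.map (shiftEntry f)) := by
  obtain ⟨F, rfl⟩ := hM
  obtain ⟨G, rfl⟩ := hN
  obtain ⟨φ, hφ, hbase, hcomm⟩ := F.exists_lift G f fun γ => (hJ γ).1
  refine ⟨F.cone G f hJ φ hφ hbase hcomm fun a b h =>
    hdisj _ (F.mem_table a) _ (G.mem_table b) h, ?_⟩
  change Multiset.map (fun s => (Sum.elim F.hom (fun b => G.hom b + 1) s,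
    Sum.elim F.deg (fun b => G.deg b + f) s)) (Finset.univ : Finset (F.B ⊕ G.B)).val = _
  have : (Finset.univ : Finset (F.B ⊕ G.B)).val = _ := Finset.val_disjSum _ _
  rw [this, Multiset.disjSum, Multiset.map_add, Multiset.map_map, Multiset.map_map,
    MonomialResolution.table, MonomialResolution.table, Multiset.map_map]
  rfl

/-! ### From strands of vector spaces to the polynomial ring -/

namespace MonomialResolution

variable {K : Type*} [Field K] {n : ℕ} {J : Set (Fin n → ℕ)} (F : MonomialResolution K n J)

/-- The finitely supported form of an exponent vector. -/
noncomputable def expo {n : ℕ} (γ : Fin n → ℕ) : Fin n →₀ ℕ := Finsupp.equivFunOnFinite.symm γ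

theorem expo_injective {n : ℕ} : Function.Injective (expo (n := n)) :=
  Finsupp.equivFunOnFinite.symm.injective

@[simp] theorem coe_expo {n : ℕ} (γ : Fin n → ℕ) : ⇑(expo γ) = γ := rfl

@[simp] theorem expo_coe {n : ℕ} (γ : Fin n →₀ ℕ) : expo (⇑γ) = γ := by ext; rfl

theorem expo_le_expo {n : ℕ} {γ δ : Fin n → ℕ} : expo γ ≤ expo δ ↔ γ ≤ δ := Iff.rfl

theorem expo_sub {n : ℕ} (γ δ : Fin n → ℕ) : expo (γ - δ) = expo γ - expo δ := by
  ext; rfl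

theorem degree_expo {n : ℕ} (γ : Fin n → ℕ) : (expo γ).degree = ∑ i, γ i := by
  rw [Finsupp.degree_eq_sum]
  rfl

/-- The matrix of the differential over the polynomial ring. -/
noncomputable def D : Matrix F.B F.B (MvPolynomial (Fin n) K) :=
  Matrix.of fun a b => monomial (expo (F.deg b - F.deg a)) (F.c a b)

/-- The component of degree `α` of a vector over the polynomial ring. -/
noncomputable def comp (α : Fin n → ℕ) (v : F.B → MvPolynomial (Fin n) K) : F.B → K :=
  open Classical in fun b => if F.deg b ≤ α then coeff (expo (α - F.deg b)) (v b) else 0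

theorem deg_le_of_comp {α : Fin n → ℕ} {v : F.B → MvPolynomial (Fin n) K} {b : F.B}
    (h : F.comp α v b ≠ 0) : F.deg b ≤ α := by
  by_contra hn
  exact h (by simp [comp, hn])

theorem comp_add_deg (γ : Fin n → ℕ) (v : F.B → MvPolynomial (Fin n) K) (b : F.B) :
    F.comp (γ + F.deg b) v b = coeff (expo γ) (v b) := by
  simp [comp]

theorem comp_injective {v w : F.B → MvPolynomial (Fin n) K}
    (h : ∀ α, F.comp α v = F.comp α w) : v = w := by
  funext b
  ext γ
  rw [← expo_coe γ, ← comp_add_deg, ← comp_add_deg, h]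

/-- Every strand of the polynomial differential is the same scalar matrix `c`, so exactness over the
polynomial ring is checked strand by strand. -/
theorem comp_mulVec (α : Fin n → ℕ) (v : F.B → MvPolynomial (Fin n) K) :
    F.comp α (F.D.mulVec v) = F.c.mulVec (F.comp α v) := by
  classical
  funext a
  simp only [comp, Matrix.mulVec, dotProduct, D, Matrix.of_apply]
  by_cases ha : F.deg a ≤ α
  · rw [if_pos ha, coeff_sum]
    refine Finset.sum_congr rfl fun b _ => ?_
    by_cases hc : F.c a b = 0
    · simp [hc]
    · have hab := (F.deg_lt_of_c a b hc).le
      rw [coeff_monomial_mul']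
      simp only [expo_le_expo, ← expo_sub]
      by_cases hb : F.deg b ≤ α
      · rw [if_pos (tsub_le_tsub_right hb _), if_pos hb,
          tsub_tsub_tsub_cancel_right hab]
      · rw [if_neg, if_neg hb, mul_zero]
        intro h
        apply hb
        have := add_le_add_left h (F.deg a)
        rwa [tsub_add_cancel_of_le hab, tsub_add_cancel_of_le ha] at this
  · rw [if_neg ha]
    refine (Finset.sum_eq_zero fun b _ => ?_).symm
    by_cases hc : F.c a b = 0
    · simp [hc]
    · rw [if_neg fun h => ha ((F.deg_lt_of_c a b hc).le.trans h), mul_zero]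

/-- Vectors over the field in finitely many degrees are the components of a vector over the
polynomial ring. -/
theorem exists_comp_eq (A : Finset (Fin n → ℕ)) (w : (Fin n → ℕ) → F.B → K)
    (hw : ∀ α b, w α b ≠ 0 → F.deg b ≤ α) (hA : ∀ α ∉ A, w α = 0) :
    ∃ W : F.B → MvPolynomial (Fin n) K, ∀ α, F.comp α W = w α := by
  classical
  refine ⟨fun b => ∑ α ∈ A, monomial (expo (α - F.deg b)) (w α b), fun β => ?_⟩
  funext b
  unfold comp
  by_cases hb : F.deg b ≤ β
  · rw [if_pos hb, coeff_sum, Finset.sum_eq_single β]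
    · simp
    · intro α _ hne
      by_cases h0 : w α b = 0
      · simp [h0]
      · rw [coeff_monomial, if_neg]
        intro h
        apply hne
        have h' := congrArg (· + F.deg b) (expo_injective h)
        simpa [tsub_add_cancel_of_le (hw α b h0), tsub_add_cancel_of_le hb] using h'
    · intro hβ
      simp [hA β hβ]
  · rw [if_neg hb]
    by_contra h
    exact hb (hw β b (Ne.symm h))

theorem exists_finset_comp_eq_zero (v : F.B → MvPolynomial (Fin n) K) :
    ∃ A : Finset (Fin n → ℕ), ∀ α ∉ A, F.comp α v = 0 := by
  classical
  refine ⟨Finset.univ.biUnion fun b => (v b).support.image fun γ : Fin n →₀ ℕ => ⇑γ + F.deg b,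
    fun α hα => ?_⟩
  funext b
  by_contra h
  apply hα
  have hb := F.deg_le_of_comp h
  simp only [Finset.mem_biUnion, Finset.mem_univ, true_and, Finset.mem_image, mem_support_iff]
  refine ⟨b, expo (α - F.deg b), ?_, ?_⟩
  · simpa [comp, hb] using h
  · rw [coe_expo, tsub_add_cancel_of_le hb]

theorem comp_zero (α : Fin n → ℕ) : F.comp α 0 = 0 := by
  funext b
  simp [comp]

theorem D_mulVec_D (v : F.B → MvPolynomial (Fin n) K) : F.D.mulVec (F.D.mulVec v) = 0 :=
  F.comp_injective fun α => by rw [comp_mulVec, comp_mulVec, mulVec_mulVec, comp_zero]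

theorem comp_base (α : Fin n → ℕ) (v : F.B → MvPolynomial (Fin n) K) :
    F.comp α v F.base = coeff (expo α) (v F.base) := by
  have := F.comp_add_deg α v F.base
  rwa [F.deg_base, add_zero] at this

theorem D_mulVec_base_mem (v : F.B → MvPolynomial (Fin n) K) (γ : Fin n →₀ ℕ)
    (h : coeff γ (F.D.mulVec v F.base) ≠ 0) : ⇑γ ∈ J := by
  rw [← expo_coe γ, ← comp_base, comp_mulVec] at h
  exact F.mem_of_ne_zero _ _ (fun b => F.deg_le_of_comp) h

theorem exists_D_mulVec_eq (v : F.B → MvPolynomial (Fin n) K) (hv : F.D.mulVec v = 0)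
    (hb : ∀ γ, coeff γ (v F.base) ≠ 0 → ⇑γ ∈ J) : ∃ w, F.D.mulVec w = v := by
  classical
  -- The last clause forces `w = 0` outside finitely many degrees, so that the strands assemble to
  -- polynomials.
  have key : ∀ α, ∃ w : F.B → K, (∀ b, w b ≠ 0 → F.deg b ≤ α) ∧
      F.c.mulVec w = F.comp α v ∧ (F.comp α v = 0 → w = 0) := by
    intro α
    by_cases h0 : F.comp α v = 0
    · exact ⟨0, by simp, by simp [h0], fun _ => rfl⟩
    · obtain ⟨w, hw, hcw⟩ := F.exact α (F.comp α v) (fun b => F.deg_le_of_comp)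
        (by rw [← comp_mulVec, hv, comp_zero])
        (fun h => hb (expo α) (by rwa [comp_base] at h))
      exact ⟨w, hw, hcw, fun h => absurd h h0⟩
  choose w hw hcw h0 using key
  obtain ⟨A, hA⟩ := F.exists_finset_comp_eq_zero v
  obtain ⟨W, hW⟩ := F.exists_comp_eq A w (fun α b => hw α b) (fun α hα => h0 α (hA α hα))
  exact ⟨W, F.comp_injective fun α => by rw [comp_mulVec, hW, hcw]⟩

/-- The basis elements of homological degree `i`, numbered. -/
noncomputable def basisEquiv (i : ℕ) :
    Fin (Fintype.card {b // F.hom b = i}) ≃ {b // F.hom b = i} :=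
  (Fintype.equivFin _).symm

/-- The extension by zero of a vector in homological degree `i`. -/
noncomputable def extend (i : ℕ)
    (v : Fin (Fintype.card {b // F.hom b = i}) → MvPolynomial (Fin n) K) :
    F.B → MvPolynomial (Fin n) K :=
  fun b => if h : F.hom b = i then v ((F.basisEquiv i).symm ⟨b, h⟩) else 0

/-- The differential in homological degree `i`. -/
noncomputable def diff (i : ℕ) : Matrix (Fin (Fintype.card {b // F.hom b = i}))
    (Fin (Fintype.card {b // F.hom b = i + 1})) (MvPolynomial (Fin n) K) :=
  F.D.submatrix (fun a => F.basisEquiv i a) (fun b => F.basisEquiv (i + 1) b)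

theorem extend_apply (i : ℕ)
    (v : Fin (Fintype.card {b // F.hom b = i}) → MvPolynomial (Fin n) K) (a) :
    F.extend i v (F.basisEquiv i a) = v a := by
  simp [extend, (F.basisEquiv i a).2]

theorem D_eq_zero {a b : F.B} (h : F.hom b ≠ F.hom a + 1) : F.D a b = 0 := by
  rw [D, Matrix.of_apply, not_imp_comm.1 (F.hom_of_c a b) h, map_zero]

theorem diff_mulVec_restrict (i : ℕ) (w : F.B → MvPolynomial (Fin n) K) :
    (F.diff i).mulVec (fun b => w (F.basisEquiv (i + 1) b)) =
      fun a => F.D.mulVec w (F.basisEquiv i a) := by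
  funext a
  simp only [Matrix.mulVec, dotProduct, diff, Matrix.submatrix_apply]
  rw [(F.basisEquiv (i + 1)).sum_comp
      (fun b : {b // F.hom b = i + 1} => F.D (F.basisEquiv i a) b * w b),
    ← Finset.sum_subtype (Finset.univ.filter fun b => F.hom b = i + 1) (by simp)
      (fun b => F.D (F.basisEquiv i a) b * w b)]
  refine Finset.sum_subset (Finset.subset_univ _) fun b _ hb => ?_
  rw [F.D_eq_zero, zero_mul]
  rw [(F.basisEquiv i a).2]
  simpa using hb

theorem diff_mulVec (i : ℕ)
    (v : Fin (Fintype.card {b // F.hom b = i + 1}) → MvPolynomial (Fin n) K) :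
    (F.diff i).mulVec v = fun a => F.D.mulVec (F.extend (i + 1) v) (F.basisEquiv i a) := by
  rw [← diff_mulVec_restrict]
  simp only [extend_apply]

theorem D_mulVec_extend (i : ℕ)
    (v : Fin (Fintype.card {b // F.hom b = i + 1}) → MvPolynomial (Fin n) K) :
    F.D.mulVec (F.extend (i + 1) v) = F.extend i ((F.diff i).mulVec v) := by
  funext a
  by_cases ha : F.hom a = i
  · rw [diff_mulVec]
    simp [extend, ha]
  · rw [extend, dif_neg ha]
    refine Finset.sum_eq_zero fun b _ => ?_
    by_cases hb : F.hom b = i + 1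
    · exact mul_eq_zero_of_left (F.D_eq_zero (by omega)) _
    · rw [extend, dif_neg hb, mul_zero]

theorem D_mulVec_extend_zero
    (v : Fin (Fintype.card {b // F.hom b = 0}) → MvPolynomial (Fin n) K) :
    F.D.mulVec (F.extend 0 v) = 0 := by
  funext a
  refine Finset.sum_eq_zero fun b _ => ?_
  by_cases hb : F.hom b = 0
  · exact mul_eq_zero_of_left (F.D_eq_zero (by omega)) _
  · rw [extend, dif_neg hb, mul_zero]

/-- The number of the basis element of homological degree zero. -/
noncomputable def baseIndex : Fin (Fintype.card {b // F.hom b = 0}) :=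
  (F.basisEquiv 0).symm ⟨F.base, F.hom_base⟩

theorem eq_baseIndex (a : Fin (Fintype.card {b // F.hom b = 0})) : a = F.baseIndex := by
  rw [baseIndex, Equiv.eq_symm_apply]
  exact Subtype.ext ((F.hom_eq_zero _).1 (F.basisEquiv 0 a).2)

theorem basisEquiv_zero (a) : (F.basisEquiv 0 a : F.B) = F.base :=
  (F.hom_eq_zero _).1 (F.basisEquiv 0 a).2

/-- The resolution as a resolution over the polynomial ring with its standard grading. -/
noncomputable def toMinimalFreeResolution (I : Ideal (MvPolynomial (Fin n) K))
    (hI : ∀ p, p ∈ I ↔ ∀ γ, coeff γ p ≠ 0 → ⇑γ ∈ J) : MinimalFreeResolution K n I where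
  rank i := Fintype.card {b // F.hom b = i}
  deg i a := ∑ j, F.deg (F.basisEquiv i a) j
  d := F.diff
  aug := I.mkQ ∘ₗ LinearMap.proj F.baseIndex
  aug_homogeneous a := by
    refine ⟨1, ?_, ?_⟩
    · simpa [F.basisEquiv_zero, F.deg_base] using isHomogeneous_one (Fin n) K
    · rw [F.eq_baseIndex a]
      simp
  d_homogeneous i a b h := by
    have hc : F.c (F.basisEquiv i a) (F.basisEquiv (i + 1) b) ≠ 0 := by
      intro h0
      exact h (by simp [diff, D, h0])
    have hle := (F.deg_lt_of_c _ _ hc).le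
    refine ⟨∑ j, (F.deg (F.basisEquiv (i + 1) b) - F.deg (F.basisEquiv i a)) j, ?_, ?_⟩
    · rw [← Finset.sum_add_distrib]
      exact Finset.sum_congr rfl fun j _ => (add_tsub_cancel_of_le (hle j)).symm
    · exact isHomogeneous_monomial _ (degree_expo _)
  aug_surjective := by
    refine (Submodule.mkQ_surjective I).comp fun p => ⟨fun _ => p, rfl⟩
  exact_zero v := by
    have h : (I.mkQ ∘ₗ LinearMap.proj F.baseIndex) v = 0 ↔
        ∀ γ, coeff γ (F.extend 0 v F.base) ≠ 0 → ⇑γ ∈ J := by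
      rw [← hI, ← F.basisEquiv_zero F.baseIndex, extend_apply]
      exact Submodule.Quotient.mk_eq_zero I
    rw [h]
    constructor
    · intro h
      obtain ⟨w, hw⟩ := F.exists_D_mulVec_eq _ (F.D_mulVec_extend_zero v) h
      refine ⟨fun b => w (F.basisEquiv 1 b), ?_⟩
      rw [Matrix.mulVecLin_apply, diff_mulVec_restrict, hw]
      simp only [extend_apply]
    · rintro ⟨w, rfl⟩ γ hγ
      rw [Matrix.mulVecLin_apply, ← D_mulVec_extend] at hγ
      exact F.D_mulVec_base_mem _ γ hγ
  exact_succ i v := by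
    simp only [Matrix.mulVecLin_apply]
    constructor
    · intro h
      obtain ⟨w, hw⟩ := F.exists_D_mulVec_eq (F.extend (i + 1) v)
        (by rw [D_mulVec_extend, h]; funext b; simp [extend])
        (by
          rw [extend, dif_neg (by rw [F.hom_base]; omega)]
          simp)
      refine ⟨fun b => w (F.basisEquiv (i + 2) b), ?_⟩
      rw [Matrix.mulVecLin_apply, diff_mulVec_restrict, hw]
      simp only [extend_apply]
    · rintro ⟨w, rfl⟩
      rw [Matrix.mulVecLin_apply, diff_mulVec, ← D_mulVec_extend, D_mulVec_D]
      rfl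
  minimal i a b := by
    by_cases hc : F.c (F.basisEquiv i a) (F.basisEquiv (i + 1) b) = 0
    · simp [diff, D, hc]
    · have hlt := F.deg_lt_of_c _ _ hc
      rw [diff, Matrix.submatrix_apply, D, Matrix.of_apply, constantCoeff_monomial, if_neg]
      intro h
      have h' : F.deg (F.basisEquiv (i + 1) b) - F.deg (F.basisEquiv i a) = 0 :=
        expo_injective (h.trans (by ext; rfl))
      exact hlt.not_ge (tsub_eq_zero_iff_le.1 h')

theorem betti_toMinimalFreeResolution (I : Ideal (MvPolynomial (Fin n) K))
    (hI : ∀ p, p ∈ I ↔ ∀ γ, coeff γ p ≠ 0 → ⇑γ ∈ J) (i j : ℕ) :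
    (F.toMinimalFreeResolution I hI).betti i j =
      F.table.countP fun q => q.1 = i ∧ ∑ l, q.2 l = j := by
  unfold MinimalFreeResolution.betti table
  rw [Multiset.countP_map]
  change _ = (Finset.univ.filter fun b => F.hom b = i ∧ ∑ l, F.deg b l = j).card
  refine Finset.card_bij (fun a _ => (F.basisEquiv i a : F.B)) ?_ ?_ ?_
  · intro a ha
    simp only [Finset.mem_filter, Finset.mem_univ, true_and] at ha ⊢
    exact ⟨(F.basisEquiv i a).2, ha⟩
  · intro a _ b _ h
    exact (F.basisEquiv i).injective (Subtype.ext h)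
  · intro b hb
    simp only [Finset.mem_filter, Finset.mem_univ, true_and] at hb
    refine ⟨(F.basisEquiv i).symm ⟨b, hb.1⟩, ?_, by simp⟩
    refine Finset.mem_filter.2 ⟨Finset.mem_univ _, ?_⟩
    change ∑ l, F.deg (F.basisEquiv i ((F.basisEquiv i).symm ⟨b, hb.1⟩)) l = j
    rw [Equiv.apply_symm_apply]
    exact hb.2

end MonomialResolution

/-! ### Resolutions of the colon ideals -/

/-- The table of a mapping cone of a nonzerodivisor. -/
def twist {n : ℕ} (f : Fin n → ℕ) (M : List (ℕ × (Fin n → ℕ))) : List (ℕ × (Fin n → ℕ)) :=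
  M ++ M.map (shiftEntry f)

/-- The operation `twist f`, if the condition `b` holds. -/
def twistIf {n : ℕ} (b : Bool) (f : Fin n → ℕ) (M : List (ℕ × (Fin n → ℕ))) :
    List (ℕ × (Fin n → ℕ)) :=
  if b then twist f M else M

theorem HasTable.congr {K : Type*} [Field K] {n : ℕ} {J J₁ : Set (Fin n → ℕ)}
    {M N : Multiset (ℕ × (Fin n → ℕ))} (h : HasTable K J M) (hJ : ∀ γ, γ ∈ J ↔ γ ∈ J₁)
    (hM : M = N) : HasTable K J₁ N := by
  obtain rfl : J = J₁ := Set.ext hJ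
  rwa [← hM]

/-- `hJ` says that the monomial of exponent `f` is a nonzerodivisor modulo the ideal, so the ideal
is its own colon. The coordinate `v` separates the old entries from the shifted ones, which makes
the cone minimal. -/
theorem HasTable.twistIf {K : Type*} [Field K] {n : ℕ} {J : Set (Fin n → ℕ)}
    {M : List (ℕ × (Fin n → ℕ))} (hM : HasTable K J M) (b : Bool) (f : Fin n → ℕ) (v : Fin n)
    (hv : 0 < f v) (hJ : b → ∀ γ, γ ∈ J ↔ γ + f ∈ J) (h0 : b → ∀ q ∈ M, q.2 v = 0) :
    HasTable K {γ | γ ∈ J ∨ (b ∧ f ≤ γ)} (twistIf b f M) := by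
  cases b with
  | false => exact hM.congr (by simp) rfl
  | true =>
    refine (hM.cone hM f (hJ rfl) ?_).congr (by simp) (by simp [_root_.twistIf, twist])
    intro p hp q _ _ h
    have h1 := h0 rfl p hp
    have h2 := congrFun h v
    rw [Pi.add_apply] at h2
    omega

/-- The table of the ideal generated by those of the first four variables that are selected. -/
def varTable (p q r s : Bool) : List (ℕ × (Fin 6 → ℕ)) :=
  twistIf p ![1, 0, 0, 0, 0, 0] (twistIf q ![0, 1, 0, 0, 0, 0] (twistIf r ![0, 0, 1, 0, 0, 0]
    (twistIf s ![0, 0, 0, 1, 0, 0] [(0, 0)])))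

/-- The exponents of the ideal generated by those of the first four variables that are selected. -/
def varSet (p q r s : Bool) : Set (Fin 6 → ℕ) :=
  {γ | (p ∧ 0 < γ 0) ∨ (q ∧ 0 < γ 1) ∨ (r ∧ 0 < γ 2) ∨ (s ∧ 0 < γ 3)}

theorem le_iff_fin_six (f γ : Fin 6 → ℕ) :
    f ≤ γ ↔ f 0 ≤ γ 0 ∧ f 1 ≤ γ 1 ∧ f 2 ≤ γ 2 ∧ f 3 ≤ γ 3 ∧ f 4 ≤ γ 4 ∧ f 5 ≤ γ 5 := by
  simp [Pi.le_def, Fin.forall_fin_succ]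

theorem hasTable_varTable (K : Type*) [Field K] (p q r s : Bool) :
    HasTable K (varSet p q r s) (varTable p q r s) := by
  have h : HasTable K (∅ : Set (Fin 6 → ℕ)) ([(0, 0)] : List (ℕ × (Fin 6 → ℕ))) :=
    hasTable_empty K 6
  have h3 := h.twistIf s ![0, 0, 0, 1, 0, 0] 3 (by simp) (by simp) (by simp)
  have h2 := h3.twistIf r ![0, 0, 1, 0, 0, 0] 2 (by simp)
    (by simp [le_iff_fin_six, -Matrix.add_cons]) (by clear * - ; decide +revert)
  have h1 := h2.twistIf q ![0, 1, 0, 0, 0, 0] 1 (by simp)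
    (by simp [le_iff_fin_six, -Matrix.add_cons]) (by clear * - ; decide +revert)
  have h0 := h1.twistIf p ![1, 0, 0, 0, 0, 0] 0 (by simp)
    (by simp [le_iff_fin_six, -Matrix.add_cons]) (by clear * - ; decide +revert)
  refine h0.congr (fun γ => ?_) rfl
  simp [le_iff_fin_six, varSet, Nat.one_le_iff_ne_zero, Nat.pos_iff_ne_zero]
  tauto

/-- The exponents of the colon ideal of the generators of a power of the path ideal that precede a
given one, which depends only on the edges that divide this generator. -/
def colonSet (p q r s : Bool) : Set (Fin 6 → ℕ) :=
  {γ | (p ∧ 0 < γ 0) ∨ (q ∧ 0 < γ 1) ∨ (r ∧ 0 < γ 2) ∨ (s ∧ 0 < γ 3) ∨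
    ((r ∨ s) ∧ 0 < γ 0 ∧ 0 < γ 1) ∨ (s ∧ 0 < γ 1 ∧ 0 < γ 2)}

/-- The table of the colon ideal `colonSet p q r s`. -/
def colonTable (p q r s : Bool) : List (ℕ × (Fin 6 → ℕ)) :=
  if s && !q && !r then
    if p then twist ![0, 1, 1, 0, 0, 0] (varTable p q r s)
    else twist ![1, 1, 0, 0, 0, 0] (varTable p q r s) ++
      (varTable true false false true).map (shiftEntry ![0, 1, 1, 0, 0, 0])
  else twistIf ((r || s) && !p && !q) ![1, 1, 0, 0, 0, 0] (varTable p q r s)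

/-- The quadric `x₀x₁` is redundant if `p` or `q` holds, and `x₁x₂` if `q` or `r` holds. A single
remaining quadric is a nonzerodivisor modulo the selected variables. Both remain only for the ideal
`⟨x₃, x₀x₁, x₁x₂⟩`; there the colon of `⟨x₃, x₀x₁⟩` by `x₁x₂` is `⟨x₀, x₃⟩`. -/
theorem hasTable_colonTable (K : Type*) [Field K] (p q r s : Bool) :
    HasTable K (colonSet p q r s) (colonTable p q r s) := by
  have hv := hasTable_varTable K p q r s
  unfold colonTable
  by_cases h : s && !q && !r
  · rw [if_pos h]
    obtain ⟨⟨rfl, rfl⟩, rfl⟩ : (s = true ∧ q = false) ∧ r = false := by simpa using h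
    cases p
    · have h1 := hv.twistIf true ![1, 1, 0, 0, 0, 0] 0 (by simp) 
        (by simp [varSet, -Matrix.add_cons]) (by clear * - ; decide +revert)
      have h2 := h1.cone (hasTable_varTable K true false false true) ![0, 1, 1, 0, 0, 0]
        (by
          intro γ
          simp [varSet, le_iff_fin_six, -Matrix.add_cons]
          omega)
        (by decide)
      refine h2.congr (fun γ => ?_) (by simp [twistIf])
      simp [colonSet, varSet, le_iff_fin_six]
      omega
    · refine (hv.twistIf true ![0, 1, 1, 0, 0, 0] 1 (by simp) 
        (by simp [varSet, -Matrix.add_cons]) (by clear * - ; decide +revert)).congr (fun γ => ?_) rfl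
      simp [colonSet, varSet, le_iff_fin_six]
      omega
  · rw [if_neg h]
    refine (hv.twistIf _ ![1, 1, 0, 0, 0, 0] 0 (by simp) ?_
      (by clear * - ; decide +revert)).congr (fun γ => ?_) rfl
    · intro hb γ
      revert hb
      cases p <;> cases q <;> simp [varSet, -Matrix.add_cons]
    · revert h
      cases p <;> cases q <;> cases r <;> cases s <;>
        simp [colonSet, varSet, le_iff_fin_six] <;> omega

/-- The total degree is the homological degree, with support in the selected variables, or one more,
with a needed quadric dividing the multidegree. This is the information from which noncancellation
follows. -/
theorem mem_colonTable (p q r s : Bool) : ∀ t ∈ colonTable p q r s,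
    t.2 0 ≤ 1 ∧ t.2 1 ≤ 1 ∧ t.2 2 ≤ 1 ∧ t.2 3 ≤ 1 ∧ t.2 4 = 0 ∧ t.2 5 = 0 ∧
    ((t.2 0 + t.2 1 + t.2 2 + t.2 3 = t.1 ∧ (t.2 0 = 0 ∨ p) ∧ (t.2 1 = 0 ∨ q) ∧
        (t.2 2 = 0 ∨ r) ∧ (t.2 3 = 0 ∨ s)) ∨
      (t.2 0 + t.2 1 + t.2 2 + t.2 3 = t.1 + 1 ∧
        ((¬ p ∧ ¬ q ∧ t.2 0 = 1 ∧ t.2 1 = 1 ∧ (t.2 2 = 0 ∨ r) ∧ (t.2 3 = 0 ∨ s)) ∨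
          (s ∧ ¬ q ∧ ¬ r ∧ t.2 1 = 1 ∧ t.2 2 = 1)))) := by
  cases p <;> cases q <;> cases r <;> cases s <;> decide

/-! ### The mapping cones over the generators of a power -/

/-- The exponent vector of the product of the edges of the path with the exponents `a`. -/
def pathExpo (a : Fin 5 → ℕ) : Fin 6 → ℕ :=
  ![a 0, a 0 + a 1, a 1 + a 2, a 2 + a 3, a 3 + a 4, a 4]

theorem lex_lt_fin_five {a b : Fin 5 → ℕ} (h : toLex a < toLex b) :
    a 0 < b 0 ∨ (a 0 = b 0 ∧ a 1 < b 1) ∨ (a 0 = b 0 ∧ a 1 = b 1 ∧ a 2 < b 2) ∨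
      (a 0 = b 0 ∧ a 1 = b 1 ∧ a 2 = b 2 ∧ a 3 < b 3) ∨
      (a 0 = b 0 ∧ a 1 = b 1 ∧ a 2 = b 2 ∧ a 3 = b 3 ∧ a 4 < b 4) := by
  obtain ⟨i, hi, hlt⟩ := h
  have hi' : ∀ j < i, a j = b j := hi
  have hlt' : a i < b i := hlt
  fin_cases i <;> simp_all [Fin.forall_fin_succ]

/-- Membership in the colon ideal comes from exchanging one edge for an earlier one: `x_i` trades
edge `i + 1` for edge `i`, `x₀x₁` trades edge `3` or `4` for edge `0`, and `x₁x₂` trades edge `4`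
for edge `1`. Conversely, linear arithmetic at the first index where `b` exceeds `a` shows that
nothing else occurs. -/
theorem add_pathExpo_mem_iff {k : ℕ} {a : Fin 5 → ℕ} (ha : ∑ i, a i = k) (γ : Fin 6 → ℕ) :
    (∃ b : Fin 5 → ℕ, ∑ i, b i = k ∧ toLex a < toLex b ∧ pathExpo b ≤ γ + pathExpo a) ↔
      γ ∈ colonSet (0 < a 1) (0 < a 2) (0 < a 3) (0 < a 4) := by
  simp only [colonSet, Set.mem_ofPred_eq, decide_eq_true_eq, le_iff_fin_six, Pi.add_apply]
  simp only [Fin.sum_univ_five] at ha ⊢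
  simp only [pathExpo, Matrix.cons_val]
  constructor
  · rintro ⟨b, hb, hlt, h0, h1, h2, h3, h4, h5⟩
    have := lex_lt_fin_five hlt
    omega
  · have first : ∀ b : Fin 5 → ℕ, a 0 < b 0 → toLex a < toLex b := fun b h => ⟨0, by simp, h⟩
    have second : ∀ b : Fin 5 → ℕ, a 0 = b 0 → a 1 < b 1 → toLex a < toLex b :=
      fun b h0 h1 => ⟨1, by intro j hj; fin_cases j <;> simp_all, h1⟩
    have third : ∀ b : Fin 5 → ℕ, a 0 = b 0 → a 1 = b 1 → a 2 < b 2 → toLex a < toLex b :=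
      fun b h0 h1 h2 => ⟨2, by intro j hj; fin_cases j <;> simp_all, h2⟩
    have fourth : ∀ b : Fin 5 → ℕ, a 0 = b 0 → a 1 = b 1 → a 2 = b 2 → a 3 < b 3 →
        toLex a < toLex b :=
      fun b h0 h1 h2 h3 => ⟨3, by intro j hj; fin_cases j <;> simp_all, h3⟩
    rintro (⟨ha, h⟩ | ⟨ha, h⟩ | ⟨ha, h⟩ | ⟨ha, h⟩ | ⟨ha | ha, h⟩ | ⟨ha, h⟩)
    · exact ⟨![a 0 + 1, a 1 - 1, a 2, a 3, a 4], by simp; omega, first _ (by simp), by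
        simp; omega⟩
    · exact ⟨![a 0, a 1 + 1, a 2 - 1, a 3, a 4], by simp; omega,
        second _ (by simp) (by simp), by simp; omega⟩
    · exact ⟨![a 0, a 1, a 2 + 1, a 3 - 1, a 4], by simp; omega,
        third _ (by simp) (by simp) (by simp), by simp; omega⟩
    · exact ⟨![a 0, a 1, a 2, a 3 + 1, a 4 - 1], by simp; omega,
        fourth _ (by simp) (by simp) (by simp) (by simp), by simp; omega⟩
    · exact ⟨![a 0 + 1, a 1, a 2, a 3 - 1, a 4], by simp; omega, first _ (by simp), by
        simp; omega⟩
    · exact ⟨![a 0 + 1, a 1, a 2, a 3, a 4 - 1], by simp; omega, first _ (by simp), by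
        simp; omega⟩
    · exact ⟨![a 0, a 1 + 1, a 2, a 3, a 4 - 1], by simp; omega,
        second _ (by simp) (by simp), by simp; omega⟩

/-- The table of the colon ideal at the generator with the exponents `a`. -/
def pathColonTable (a : Fin 5 → ℕ) : List (ℕ × (Fin 6 → ℕ)) :=
  colonTable (0 < a 1) (0 < a 2) (0 < a 3) (0 < a 4)

/-- No entries cancel in the mapping cones. -/
theorem pathColonTable_disjoint {a b : Fin 5 → ℕ} {t u : ℕ × (Fin 6 → ℕ)}
    (hab : ∑ i, a i = ∑ i, b i) (ht : t ∈ pathColonTable b) (hu : u ∈ pathColonTable a)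
    (hhom : t.1 + 1 = u.1) :
    t.2 + pathExpo b ≠ u.2 + pathExpo a := by
  intro h
  simp only [Fin.sum_univ_five] at hab
  have h1 := mem_colonTable _ _ _ _ t ht
  have h2 := mem_colonTable _ _ _ _ u hu
  simp only [decide_eq_true_eq] at h1 h2
  have e0 := congrFun h 0
  have e1 := congrFun h 1
  have e2 := congrFun h 2
  have e3 := congrFun h 3
  have e4 := congrFun h 4
  have e5 := congrFun h 5
  simp only [Pi.add_apply, pathExpo, Matrix.cons_val] at e0 e1 e2 e3 e4 e5
  obtain ⟨h10, h11, h12, h13, h14, h15, h1⟩ := h1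
  obtain ⟨h20, h21, h22, h23, h24, h25, h2⟩ := h2
  -- The two generators have equal total degree, so a coincidence forces `t` into row one and `u`
  -- into row zero. The exponents at a quadric of `b` then contradict the support condition on `u`.
  rcases h2 with ⟨g0, g1, g2, g3, g4⟩ | ⟨g0, -⟩
  · rcases h1 with ⟨f0, -⟩ | ⟨f0, ⟨f1, f2, f3, f4, f5, f6⟩ | f1⟩
    · omega
    · omega
    · omega
  · omega

theorem hasTable_path (K : Type*) [Field K] {k : ℕ} (hk : 1 ≤ k) (s : Finset (Fin 5 → ℕ))
    (hs : ∀ a ∈ s, ∑ i, a i = k)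
    (hclosed : ∀ a ∈ s, ∀ b : Fin 5 → ℕ, ∑ i, b i = k → toLex a < toLex b → b ∈ s) :
    HasTable K {γ | ∃ a ∈ s, pathExpo a ≤ γ}
      ({(0, 0)} + ∑ a ∈ s, Multiset.map (shiftEntry (pathExpo a)) (pathColonTable a)) := by
  classical
  -- Inserting the minimum last keeps the set upward closed, so the earlier generators are exactly
  -- those lexicographically larger than `a`, as the colon computation requires.
  induction s using Finset.induction_on_min_value (fun a : Fin 5 → ℕ => toLex a) with
  | empty => exact (hasTable_empty K 6).congr (by simp) (by simp)
  | insert a s has hmin ih =>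
    have hlt : ∀ x ∈ s, toLex a < toLex x := fun x hx =>
      lt_of_le_of_ne (hmin x hx) fun h => has (by rwa [toLex.injective h])
    have hmem : ∀ b, b ∈ s ↔ ∑ i, b i = k ∧ toLex a < toLex b := by
      intro b
      refine ⟨fun hb => ⟨hs b (Finset.mem_insert_of_mem hb), hlt b hb⟩, fun hb => ?_⟩
      refine Finset.mem_of_mem_insert_of_ne
        (hclosed a (Finset.mem_insert_self a s) b hb.1 hb.2) ?_
      rintro rfl
      exact lt_irrefl _ hb.2
    have hM := ih (fun b hb => hs b (Finset.mem_insert_of_mem hb)) (by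
      intro b hb c hc hbc
      exact (hmem c).2 ⟨hc, (hlt b hb).trans hbc⟩)
    have ha := hs a (Finset.mem_insert_self a s)
    refine (hM.cone (hasTable_colonTable K (0 < a 1) (0 < a 2) (0 < a 3) (0 < a 4)) (pathExpo a)
      (fun γ => ?_) ?_).congr (fun γ => ?_) ?_
    · rw [← add_pathExpo_mem_iff ha]
      simp [hmem, and_assoc]
    · intro t ht u hu htu
      rw [Multiset.mem_add, Multiset.mem_sum] at ht
      rcases ht with ht | ⟨b, hb, ht⟩
      · obtain rfl := Multiset.mem_singleton.1 ht
        intro h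
        have e0 := congrFun h 0
        have e1 := congrFun h 1
        have e2 := congrFun h 2
        have e3 := congrFun h 3
        have e4 := congrFun h 4
        have e5 := congrFun h 5
        simp only [Pi.add_apply, Pi.zero_apply, pathExpo, Matrix.cons_val] at e0 e1 e2 e3 e4 e5
        rw [Fin.sum_univ_five] at ha
        omega
      · obtain ⟨t', ht', rfl⟩ := Multiset.mem_map.1 ht
        exact pathColonTable_disjoint (ha.trans ((hmem b).1 hb).1.symm) ht' hu htu
    · simp [or_comm]
    · rw [Finset.sum_insert has, add_assoc, add_comm (Multiset.map _ _)]
      rfl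

/-- The exponents of the monomials in the `k`-th power of the path ideal. -/
def pathPowerSet (k : ℕ) : Set (Fin 6 → ℕ) :=
  {γ | ∃ a : Fin 5 → ℕ, ∑ i, a i = k ∧ pathExpo a ≤ γ}

theorem hasTable_pathPowerSet (K : Type*) [Field K] {k : ℕ} (hk : 1 ≤ k) :
    HasTable K (pathPowerSet k) ({(0, 0)} + ∑ a ∈ Finset.Nat.antidiagonalTuple 5 k,
      Multiset.map (shiftEntry (pathExpo a)) (pathColonTable a)) :=
  (hasTable_path K hk (Finset.Nat.antidiagonalTuple 5 k)
    (fun _ => Finset.Nat.mem_antidiagonalTuple.1)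
    (fun _ _ _ hb _ => Finset.Nat.mem_antidiagonalTuple.2 hb)).congr
    (by simp [pathPowerSet, Finset.Nat.mem_antidiagonalTuple]) rfl

/-! ### Monomials in the powers of the path ideal -/

section PowerOfPathIdeal

variable (K : Type*) [Field K]

/-- The product of the edges of the path with the exponents `a`. -/
noncomputable def edgeMonomial (a : Fin 5 → ℕ) : MvPolynomial (Fin 6) K :=
  monomial (MonomialResolution.expo (pathExpo a)) 1

theorem pathExpo_add (a b : Fin 5 → ℕ) : pathExpo (a + b) = pathExpo a + pathExpo b := by
  funext i
  fin_cases i <;> simp [pathExpo] <;> ring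

theorem edgeMonomial_add (a b : Fin 5 → ℕ) :
    edgeMonomial K (a + b) = edgeMonomial K a * edgeMonomial K b := by
  unfold edgeMonomial
  rw [monomial_mul, one_mul, pathExpo_add]
  exact congrArg (fun γ => monomial γ (1 : K)) (Finsupp.ext fun _ => rfl)

theorem pathIdeal_eq_span :
    pathIdeal K = Ideal.span (Set.range fun i : Fin 5 => edgeMonomial K (Pi.single i 1)) := by
  have key : ∀ i : Fin 5, edgeMonomial K (Pi.single i 1) = X i.castSucc * X i.succ := by
    intro i
    rw [edgeMonomial, X, X, monomial_mul, one_mul]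
    refine congrArg (fun γ => monomial γ (1 : K)) (Finsupp.ext fun j => ?_)
    fin_cases i <;> fin_cases j <;> simp [pathExpo]
  unfold pathIdeal
  congr 1
  simp only [key]
  ext p
  simp [Fin.exists_fin_succ, eq_comm]

theorem pathIdeal_pow_eq_span (k : ℕ) :
    pathIdeal K ^ k = Ideal.span (edgeMonomial K '' {a | ∑ i, a i = k}) := by
  induction k with
  | zero =>
    rw [pow_zero, Ideal.one_eq_top, eq_comm, Ideal.eq_top_iff_one]
    refine Ideal.subset_span ⟨0, by simp, ?_⟩
    rw [edgeMonomial, show MonomialResolution.expo (pathExpo 0) = 0 from ?_]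
    · rfl
    · ext i
      fin_cases i <;> rfl
  | succ k ih =>
    rw [pow_succ, ih, pathIdeal_eq_span, Ideal.span_mul_span']
    congr 1
    ext p
    simp only [Set.mem_mul, Set.mem_image, Set.mem_range]
    constructor
    · rintro ⟨_, ⟨a, ha, rfl⟩, _, ⟨i, rfl⟩, rfl⟩
      refine ⟨a + Pi.single i 1, ?_, edgeMonomial_add K _ _⟩
      have ha' : ∑ i, a i = k := ha
      change ∑ j, (a j + (Pi.single i 1 : Fin 5 → ℕ) j) = k + 1
      rw [Finset.sum_add_distrib, ha']
      simp
    · rintro ⟨a, ha, rfl⟩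
      have ha' : ∑ i, a i = k + 1 := ha
      obtain ⟨i, -, hi⟩ := Finset.exists_ne_zero_of_sum_ne_zero (by rw [ha']; omega)
      have hle : Pi.single i 1 ≤ a := by
        intro j
        by_cases h : j = i
        · subst h
          rw [Pi.single_eq_same]
          exact Nat.one_le_iff_ne_zero.2 hi
        · simp [h]
      refine ⟨_, ⟨a - Pi.single i 1, ?_, rfl⟩, _, ⟨i, rfl⟩, ?_⟩
      · have h := congrArg (fun b : Fin 5 → ℕ => ∑ j, b j) (tsub_add_cancel_of_le hle)
        simp only [Pi.add_apply, Finset.sum_add_distrib, ha'] at h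
        rw [Finset.sum_pi_single'] at h
        change ∑ j, (a - Pi.single i 1 : Fin 5 → ℕ) j = k
        simpa using h
      · rw [← edgeMonomial_add, tsub_add_cancel_of_le hle]

theorem mem_pathIdeal_pow (k : ℕ) (p : MvPolynomial (Fin 6) K) :
    p ∈ pathIdeal K ^ k ↔ ∀ γ, coeff γ p ≠ 0 → ⇑γ ∈ pathPowerSet k := by
  have h : edgeMonomial K '' {a | ∑ i, a i = k} = (fun s => monomial s (1 : K)) ''
      ((fun a => MonomialResolution.expo (pathExpo a)) '' {a | ∑ i, a i = k}) := by
    rw [Set.image_image]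
    rfl
  rw [pathIdeal_pow_eq_span, h, mem_ideal_span_monomial_image]
  simp only [mem_support_iff, Set.exists_mem_image]
  rfl

theorem homogeneousComponent_mem_pathIdeal_pow (k : ℕ) (p : MvPolynomial (Fin 6) K)
    (hp : p ∈ pathIdeal K ^ k) (m : ℕ) : homogeneousComponent m p ∈ pathIdeal K ^ k := by
  rw [mem_pathIdeal_pow] at hp ⊢
  intro γ hγ
  rw [coeff_homogeneousComponent] at hγ
  exact hp γ fun h => hγ (by simp [h])

end PowerOfPathIdeal

/-! ### Counting exponent tuples by their positive entries -/

section Counting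

theorem sum_antidiagonalTuple_succ {m k : ℕ} (f : (Fin (m + 1) → ℕ) → ℕ) :
    ∑ t ∈ Finset.Nat.antidiagonalTuple (m + 1) k, f t =
      ∑ x ∈ Finset.HasAntidiagonal.antidiagonal k,
        ∑ t ∈ Finset.Nat.antidiagonalTuple m x.2, f (Fin.cons x.1 t) := by
  change (List.map f (List.Nat.antidiagonalTuple (m + 1) k)).sum =
    (List.map (fun x : ℕ × ℕ => (List.map (fun t => f (Fin.cons x.1 t))
      (List.Nat.antidiagonalTuple m x.2)).sum) (List.Nat.antidiagonal k)).sum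
  simp [List.Nat.antidiagonalTuple, List.flatMap, List.map_flatten, List.sum_flatten,
    Function.comp_def]

theorem sum_antidiagonal_choose_snd (k p : ℕ) :
    ∑ x ∈ Finset.HasAntidiagonal.antidiagonal k, x.2.choose p = (k + 1).choose (p + 1) := by
  induction k with
  | zero => simp [Nat.choose_succ_succ']
  | succ k ih =>
    rw [Finset.Nat.sum_antidiagonal_succ, ih, Nat.choose_succ_succ' (k + 1)]

theorem sum_antidiagonal_choose_mul (k p : ℕ) (u : Bool → ℕ) :
    ∑ x ∈ Finset.HasAntidiagonal.antidiagonal k, x.2.choose p * u (0 < x.1) =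
      k.choose p * u false + k.choose (p + 1) * u true := by
  cases k with
  | zero => simp
  | succ k =>
    rw [Finset.Nat.sum_antidiagonal_succ]
    simp [← Finset.sum_mul, sum_antidiagonal_choose_snd]

/-- The number of tuples of sum `k` with positive entries at given positions and zeros at the
others, except for the last entry, which is arbitrary, is a binomial coefficient. -/
theorem sum_antidiagonalTuple_pattern (m k : ℕ) (g : (Fin m → Bool) → ℕ) :
    ∑ t ∈ Finset.Nat.antidiagonalTuple (m + 1) k, g (fun i => decide (0 < t i.castSucc)) =
      ∑ s : Fin m → Bool, k.choose (∑ i, (s i).toNat) * g s := by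
  induction m generalizing k with
  | zero =>
    rw [Fintype.sum_subsingleton _ (fun i : Fin 0 => i.elim0)]
    simpa using congrArg g (Subsingleton.elim _ _)
  | succ m ih =>
    rw [sum_antidiagonalTuple_succ]
    have h1 : ∀ x ∈ Finset.HasAntidiagonal.antidiagonal k,
        (∑ t ∈ Finset.Nat.antidiagonalTuple (m + 1) x.2,
          g (fun i => decide (0 < (Fin.cons x.1 t : Fin (m + 2) → ℕ) i.castSucc))) =
        ∑ s : Fin m → Bool, x.2.choose (∑ i, (s i).toNat) * g (Fin.cons (decide (0 < x.1)) s) := by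
      intro x _
      rw [← ih x.2 (fun s => g (Fin.cons (decide (0 < x.1)) s))]
      refine Finset.sum_congr rfl fun t _ => congrArg g ?_
      funext i
      refine Fin.cases ?_ (fun i => ?_) i <;> simp
    rw [Finset.sum_congr rfl h1, Finset.sum_comm,
      ← (Fin.consEquiv fun _ : Fin (m + 1) => Bool).sum_comp, Fintype.sum_prod_type,
      Fintype.sum_bool, ← Finset.sum_add_distrib]
    refine Finset.sum_congr rfl fun s _ => ?_
    rw [sum_antidiagonal_choose_mul k _ (fun b => g (Fin.cons b s))]
    simp [Fin.consEquiv, Fin.sum_univ_succ, add_comm]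

theorem sum_antidiagonalTuple_five (k : ℕ) (g : Bool → Bool → Bool → Bool → ℕ) :
    ∑ a ∈ Finset.Nat.antidiagonalTuple 5 k, g (0 < a 1) (0 < a 2) (0 < a 3) (0 < a 4) =
      ∑ p, ∑ q, ∑ r, ∑ s, k.choose (p.toNat + q.toNat + r.toNat + s.toNat) * g p q r s := by
  let e : (Fin 4 → Bool) ≃ Bool × Bool × Bool × Bool :=
    { toFun := fun s => (s 3, s 2, s 1, s 0)
      invFun := fun x => ![x.2.2.2, x.2.2.1, x.2.1, x.1]
      left_inv := fun s => by
        funext i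
        fin_cases i <;> rfl
      right_inv := fun x => rfl }
  have he : ∑ p, ∑ q, ∑ r, ∑ s, k.choose (p.toNat + q.toNat + r.toNat + s.toNat) * g p q r s =
      ∑ s : Fin 4 → Bool, k.choose (∑ i, (s i).toNat) * g (s 3) (s 2) (s 1) (s 0) := by
    simp only [← Fintype.sum_prod_type']
    rw [← e.sum_comp]
    refine Finset.sum_congr rfl fun s _ => ?_
    rw [Fin.sum_univ_four]
    congr 2
    change (s 3).toNat + (s 2).toNat + (s 1).toNat + (s 0).toNat = _
    omega
  rw [he, ← sum_antidiagonalTuple_pattern 4 k fun s => g (s 3) (s 2) (s 1) (s 0)]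
  -- The unrestricted entry is `a 0` here but the last one in `sum_antidiagonalTuple_pattern`, hence
  -- the reversal.
  refine Finset.sum_nbij' (fun a => a ∘ Fin.rev) (fun a => a ∘ Fin.rev) ?_ ?_ ?_ ?_ ?_
  · intro a ha
    rw [Finset.Nat.mem_antidiagonalTuple] at ha ⊢
    rw [← ha]
    exact Equiv.sum_comp Fin.revPerm a
  · intro a ha
    rw [Finset.Nat.mem_antidiagonalTuple] at ha ⊢
    rw [← ha]
    exact Equiv.sum_comp Fin.revPerm a
  · intro a _
    funext i
    simp
  · intro a _
    funext i
    simp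
  · intro a _
    rfl

end Counting

/-! ### The Betti numbers -/

section Betti

/-- The second row is counted by patterns with one or two positive entries, which yield `k.choose 1`
and `k.choose 2`. -/
theorem sq_eq_two_mul_choose_two_add (k : ℕ) : k ^ 2 = 2 * k.choose 2 + k := by
  induction k with
  | zero => rfl
  | succ k ih =>
    rw [Nat.choose_succ_succ' k 1, Nat.choose_one_right]
    linarith

/-- The entries of the table of a colon ideal in row one, by column. -/
def quadricCount (p q r s : Bool) (i : ℕ) : ℕ :=
  if s && !q && !r then
    if p then [0, 1, 2, 1, 0].getD i 0 else [0, 2, 3, 1, 0].getD i 0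
  else if (r || s) && !p && !q then
    if r && s then [0, 1, 2, 1, 0].getD i 0 else [0, 1, 1, 0, 0].getD i 0
  else 0

theorem countP_colonTable_row_zero (p q r s : Bool) : ∀ i < 5,
    (colonTable p q r s).countP (fun t => t.1 = i ∧ ∑ l, t.2 l = i) =
      (s.toNat + r.toNat + q.toNat + p.toNat).choose i := by
  cases p <;> cases q <;> cases r <;> cases s <;> decide

theorem countP_colonTable_row_one (p q r s : Bool) : ∀ i < 5,
    (colonTable p q r s).countP (fun t => t.1 = i ∧ ∑ l, t.2 l = i + 1) =
      quadricCount p q r s i := by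
  cases p <;> cases q <;> cases r <;> cases s <;> decide

theorem mem_colonTable_degree (p q r s : Bool) (t : ℕ × (Fin 6 → ℕ))
    (ht : t ∈ colonTable p q r s) :
    t.1 ≤ 4 ∧ (∑ l, t.2 l = t.1 ∨ ∑ l, t.2 l = t.1 + 1) := by
  have h := mem_colonTable p q r s t ht
  rw [Fin.sum_univ_six]
  rcases h with ⟨h0, h1, h2, h3, h4, h5, ⟨h6, -⟩ | ⟨h6, -⟩⟩ <;> omega

theorem sum_pathExpo (a : Fin 5 → ℕ) : ∑ l, pathExpo a l = 2 * ∑ i, a i := by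
  simp [Fin.sum_univ_six, Fin.sum_univ_five, pathExpo]
  ring

theorem countP_pathTable (k i j : ℕ) :
    Multiset.countP (fun q : ℕ × (Fin 6 → ℕ) => q.1 = i ∧ ∑ l, q.2 l = j)
      ({(0, 0)} + ∑ a ∈ Finset.Nat.antidiagonalTuple 5 k,
        Multiset.map (shiftEntry (pathExpo a)) (pathColonTable a)) =
    (if i = 0 ∧ j = 0 then 1 else 0) +
      ∑ p, ∑ q, ∑ r, ∑ s, k.choose (p.toNat + q.toNat + r.toNat + s.toNat) *
        (colonTable p q r s).countP
          (fun t => t.1 + 1 = i ∧ ∑ l, t.2 l + 2 * k = j) := by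
  rw [← sum_antidiagonalTuple_five k fun p q r s => (colonTable p q r s).countP
    (fun t => t.1 + 1 = i ∧ ∑ l, t.2 l + 2 * k = j), Multiset.countP_add]
  congr 1
  · rw [← Multiset.cons_zero, Multiset.countP_cons]
    simp [eq_comm]
  · have hsum := map_sum (Multiset.countPAddMonoidHom
      fun q : ℕ × (Fin 6 → ℕ) => q.1 = i ∧ ∑ l, q.2 l = j)
      (fun a => Multiset.map (shiftEntry (pathExpo a)) (pathColonTable a : Multiset _))
      (Finset.Nat.antidiagonalTuple 5 k)
    refine hsum.trans (Finset.sum_congr rfl fun a ha => ?_)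
    rw [Finset.Nat.mem_antidiagonalTuple] at ha
    simp only [Multiset.coe_countPAddMonoidHom, Multiset.map_coe, Multiset.coe_countP,
      List.countP_map, pathColonTable]
    refine List.countP_congr fun t _ => ?_
    simp only [Function.comp_apply, shiftEntry, Pi.add_apply, Finset.sum_add_distrib, sum_pathExpo,
      ha]

theorem countP_pathTable_eq (k i j : ℕ) :
    Multiset.countP (fun q : ℕ × (Fin 6 → ℕ) => q.1 = i ∧ ∑ l, q.2 l = j)
      ({(0, 0)} + ∑ a ∈ Finset.Nat.antidiagonalTuple 5 k,
        Multiset.map (shiftEntry (pathExpo a)) (pathColonTable a)) = pathDiagram k i j := by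
  rw [countP_pathTable]
  cases i with
  | zero =>
    have h : ∀ p q r s, (colonTable p q r s).countP
        (fun t => t.1 + 1 = 0 ∧ ∑ l, t.2 l + 2 * k = j) = 0 := by simp
    simp only [h, mul_zero, Finset.sum_const_zero, pathDiagram, pathRow₁, pathRow₂, ite_self,
      add_zero]
  | succ i =>
    have hzero : (∀ p q r s, (colonTable p q r s).countP
        (fun t => t.1 + 1 = i + 1 ∧ ∑ l, t.2 l + 2 * k = j) = 0) →
        ∑ p, ∑ q, ∑ r, ∑ s, k.choose (p.toNat + q.toNat + r.toNat + s.toNat) *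
          (colonTable p q r s).countP
            (fun t => t.1 + 1 = i + 1 ∧ ∑ l, t.2 l + 2 * k = j) = 0 := by
      intro h
      simp only [h, mul_zero, Finset.sum_const_zero]
    have hne : ¬ (i + 1 = 0 ∧ j = 0) := by omega
    rw [if_neg hne, zero_add, pathDiagram, if_neg hne]
    by_cases hi : i < 5
    · by_cases h1 : j = i + 2 * k
      · have h : ∀ p q r s, (colonTable p q r s).countP
            (fun t => t.1 + 1 = i + 1 ∧ ∑ l, t.2 l + 2 * k = j) =
              (s.toNat + r.toNat + q.toNat + p.toNat).choose i := by
          intro p q r s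
          rw [← countP_colonTable_row_zero p q r s i hi, h1]
          simp only [add_left_inj]
        rw [if_pos (by omega)]
        simp only [h, Fintype.sum_bool]
        -- Pascal's rule reduces both sides to the binomials `k.choose t`; the identities are
        -- instances of Vandermonde's.
        interval_cases i <;>
          simp [pathRow₁, Nat.choose_succ_succ'] <;> ring
      · by_cases h2 : j = i + 1 + 2 * k
        · have h : ∀ p q r s, (colonTable p q r s).countP
              (fun t => t.1 + 1 = i + 1 ∧ ∑ l, t.2 l + 2 * k = j) = quadricCount p q r s i := by
            intro p q r s
            rw [← countP_colonTable_row_one p q r s i hi, h2]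
            simp only [add_left_inj]
          rw [if_neg (by omega), if_pos h2]
          simp only [h, Fintype.sum_bool]
          have hk2 := sq_eq_two_mul_choose_two_add k
          interval_cases i <;>
            simp [pathRow₂, quadricCount] <;> ring_nf <;> simp only [hk2] <;> ring
        · rw [if_neg (by omega), if_neg h2]
          refine hzero fun p q r s => List.countP_eq_zero.2 ?_
          intro t ht
          have := mem_colonTable_degree _ _ _ _ t ht
          rw [decide_eq_true_eq]
          omega
    · have hr : pathRow₁ k (i + 1) = 0 ∧ pathRow₂ k (i + 1) = 0 := by
        obtain ⟨m, rfl⟩ := Nat.exists_eq_add_of_le (not_lt.1 hi)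
        rw [show 5 + m + 1 = m + 6 by omega]
        exact ⟨rfl, rfl⟩
      rw [hr.1, hr.2, ite_self, ite_self]
      refine hzero fun p q r s => List.countP_eq_zero.2 ?_
      intro t ht
      have := mem_colonTable_degree _ _ _ _ t ht
      rw [decide_eq_true_eq]
      omega

end Betti

/-- The Betti numbers of the powers of the path ideal. -/
theorem exists_resolution_pathIdeal_pow (K : Type*) [Field K] {k : ℕ} (hk : 1 ≤ k) :
    ∃ F : MinimalFreeResolution K 6 (pathIdeal K ^ k),
      ∀ i j, F.betti i j = pathDiagram k i j := by
  obtain ⟨F, hF⟩ := hasTable_pathPowerSet K hk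
  refine ⟨F.toMinimalFreeResolution _ (mem_pathIdeal_pow K k), fun i j => ?_⟩
  rw [F.betti_toMinimalFreeResolution, hF, countP_pathTable_eq k i j]

/-! ### Support and moment equation of the Betti diagram -/

section Diagram

/-- The positions of the Betti diagrams of the powers of the path ideal. -/
def pathPositions (k : ℕ) : List (ℕ × ℕ) :=
  [(0, 0), (1, 2 * k), (2, 2 * k + 1), (2, 2 * k + 2), (3, 2 * k + 2), (3, 2 * k + 3),
    (4, 2 * k + 3), (4, 2 * k + 4), (5, 2 * k + 4)]

theorem mem_pathPositions_of_pathDiagram_ne_zero {k i j : ℕ} (h : pathDiagram k i j ≠ 0) :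
    (i, j) ∈ pathPositions k := by
  simp only [pathPositions, List.mem_cons, Prod.mk.injEq, List.not_mem_nil, or_false]
  unfold pathDiagram at h
  split_ifs at h with h0 h1 h2
  · omega
  · have : i = 1 ∨ i = 2 ∨ i = 3 ∨ i = 4 ∨ i = 5 := by
      by_contra hn
      apply h
      unfold pathRow₁
      split <;> simp_all
    omega
  · have : i = 2 ∨ i = 3 ∨ i = 4 := by
      by_contra hn
      apply h
      unfold pathRow₂
      split <;> simp_all
    omega
  · exact absurd rfl h

theorem mem_pathPositions_of_translatedSequence {k i j : ℕ} {s : Fin 8}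
    (h : (translatedSequence k s)[i]? = some j) : (i, j) ∈ pathPositions k := by
  simp only [pathPositions, List.mem_cons, Prod.mk.injEq, List.not_mem_nil, or_false]
  have hi : i < 6 := by
    by_contra hi
    have : (translatedSequence k s).length ≤ 6 := by
      fin_cases s <;> simp [translatedSequence]
    rw [List.getElem?_eq_none (by omega)] at h
    exact absurd h (by simp)
  fin_cases s <;> interval_cases i <;> simp [translatedSequence] at h <;> omega

theorem cast_choose_three (n : ℕ) : (n.choose 3 : ℝ) = n * (n - 1) * (n - 2) / 6 := by
  induction n with
  | zero => simp
  | succ n ih =>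
    rw [Nat.choose_succ_succ', Nat.cast_add, ih, Nat.cast_choose_two]
    push_cast
    ring

theorem cast_choose_four (n : ℕ) :
    (n.choose 4 : ℝ) = n * (n - 1) * (n - 2) * (n - 3) / 24 := by
  induction n with
  | zero => simp
  | succ n ih =>
    rw [Nat.choose_succ_succ', Nat.cast_add, ih, cast_choose_three]
    push_cast
    ring

theorem pathDiagram_zero_zero (k : ℕ) : pathDiagram k 0 0 = 1 := by simp [pathDiagram]

theorem pathDiagram_row_one (k i : ℕ) :
    pathDiagram k (i + 1) (2 * k + i) = pathRow₁ k (i + 1) := by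
  rw [pathDiagram, if_neg (by omega), if_pos (by omega)]

theorem pathDiagram_row_two (k i : ℕ) :
    pathDiagram k (i + 1) (2 * k + (i + 1)) = pathRow₂ k (i + 1) := by
  rw [pathDiagram, if_neg (by omega), if_neg (by omega), if_pos (by omega)]

/-- The Betti diagram satisfies the equation that a module of codimension at least three satisfies
for the polynomial `(t - 2k)²`. -/
theorem pathDiagram_moment (k : ℕ) :
    4 * (k : ℝ) ^ 2 * pathDiagram k 0 0 + pathDiagram k 2 (2 * k + 1) +
      4 * pathDiagram k 2 (2 * k + 2) - 4 * pathDiagram k 3 (2 * k + 2) -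
      9 * pathDiagram k 3 (2 * k + 3) + 9 * pathDiagram k 4 (2 * k + 3) +
      16 * pathDiagram k 4 (2 * k + 4) - 16 * pathDiagram k 5 (2 * k + 4) = 0 := by
  rw [pathDiagram_zero_zero, pathDiagram_row_one k 1, pathDiagram_row_one k 2,
    pathDiagram_row_one k 3, pathDiagram_row_one k 4, pathDiagram_row_two k 1,
    pathDiagram_row_two k 2, pathDiagram_row_two k 3]
  simp only [pathRow₁, pathRow₂, Nat.cast_mul, cast_choose_four]
  push_cast
  ring

end Diagram

/-! ### Pure diagrams that can occur in a decomposition -/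

section Pure

theorem pureDiagram_pos {d : List ℕ} (hd : IsDegreeSequence d) {i j : ℕ} (h : d[i]? = some j) :
    0 < pureDiagram d i j := by
  rw [pureDiagram, if_pos h]
  refine div_pos (List.prod_pos ?_) (List.prod_pos ?_)
  · intro x hx
    obtain ⟨hne, hp⟩ := hd
    cases d with
    | nil => exact absurd rfl hne
    | cons a d =>
      simp only [List.tail_cons, List.bind_eq_flatMap, List.pure_def, List.mem_map,
        List.mem_flatMap, List.mem_singleton] at hx
      obtain ⟨_, ⟨l, hl, rfl⟩, rfl⟩ := hx
      have : a < l := (List.pairwise_cons.1 hp).1 l hl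
      simpa using this
  · intro x hx
    simp only [List.bind_eq_flatMap, List.pure_def, List.mem_map,
      List.mem_flatMap, List.mem_singleton] at hx
    obtain ⟨_, ⟨l, hl, rfl⟩, rfl⟩ := hx
    obtain ⟨m, hmi, hlm⟩ := List.mem_eraseIdx_iff_getElem?.1 hl
    rw [abs_pos, sub_ne_zero]
    intro hlj
    obtain rfl : l = j := by exact_mod_cast hlj
    have hnodup : d.Nodup := hd.2.imp fun h => h.ne
    have hm : m < d.length := (List.getElem?_eq_some_iff.1 hlm).1
    exact hmi ((List.getElem?_inj hm hnodup).1 (hlm.trans h.symm))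

theorem pureDiagram_eq_zero {d : List ℕ} {i j : ℕ} (h : d[i]? ≠ some j) :
    pureDiagram d i j = 0 := if_neg h

theorem pureDiagram_nonneg {d : List ℕ} (hd : IsDegreeSequence d) (i j : ℕ) :
    0 ≤ pureDiagram d i j := by
  by_cases h : d[i]? = some j
  · exact (pureDiagram_pos hd h).le
  · exact (pureDiagram_eq_zero h).ge

/-- Weights and entries are nonnegative, so nothing cancels a positive entry. -/
theorem IsDecomposition.ne_zero {β : ℕ → ℕ → ℕ} {w : List ℕ →₀ ℝ} (hw : IsDecomposition β w)
    {d : List ℕ} (hd : d ∈ w.support) {i j : ℕ} (h : d[i]? = some j) : β i j ≠ 0 := by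
  obtain ⟨hs, h0, hβ⟩ := hw
  intro hz
  have h1 := hβ i j
  rw [hz, Nat.cast_zero, eq_comm, Finsupp.sum, Finset.sum_eq_zero_iff_of_nonneg
    (fun e he => mul_nonneg (h0 e) (pureDiagram_nonneg (hs e he) i j))] at h1
  exact mul_ne_zero (Finsupp.mem_support_iff.1 hd) (pureDiagram_pos (hs d hd) h).ne' (h1 d hd)

/-- The degree sequences that fit into the Betti diagram. -/
theorem degreeSequence_cases {k : ℕ} {d : List ℕ} (hd : IsDegreeSequence d)
    (h : ∀ i j, d[i]? = some j → (i, j) ∈ pathPositions k) :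
    (d = [0] ∨ d = [0, 2 * k] ∨ d = [0, 2 * k, 2 * k + 1] ∨ d = [0, 2 * k, 2 * k + 2]) ∨
      d ∈ Set.range (translatedSequence k) := by
  simp only [pathPositions, List.mem_cons, Prod.mk.injEq, List.not_mem_nil, or_false] at h
  obtain ⟨hne, hp⟩ := hd
  match d with
  | [] => exact absurd rfl hne
  | [a] =>
    have h0 := h 0 a rfl
    left; left
    simp; omega
  | [a, b] =>
    have h0 := h 0 a rfl
    have h1 := h 1 b rfl
    left; right; left
    simp; omega
  | [a, b, c] =>
    have h0 := h 0 a rfl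
    have h1 := h 1 b rfl
    have h2 := h 2 c rfl
    left; right; right
    simp; omega
  | [a, b, c, e] =>
    have h0 := h 0 a rfl
    have h1 := h 1 b rfl
    have h2 := h 2 c rfl
    have h3 := h 3 e rfl
    simp only [List.pairwise_cons, List.mem_cons, List.not_mem_nil, or_false,
      forall_eq_or_imp, forall_eq] at hp
    clear h
    obtain rfl : a = 0 := by omega
    obtain rfl : b = 2 * k := by omega
    have : (c = 2 * k + 1 ∧ e = 2 * k + 2) ∨
        (c = 2 * k + 1 ∧ e = 2 * k + 3) ∨
        (c = 2 * k + 2 ∧ e = 2 * k + 3) := by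
      omega
    rcases this with ⟨rfl, rfl⟩ | ⟨rfl, rfl⟩ | ⟨rfl, rfl⟩
    · exact Or.inr ⟨0, rfl⟩
    · exact Or.inr ⟨1, rfl⟩
    · exact Or.inr ⟨2, rfl⟩
  | [a, b, c, e, f] =>
    have h0 := h 0 a rfl
    have h1 := h 1 b rfl
    have h2 := h 2 c rfl
    have h3 := h 3 e rfl
    have h4 := h 4 f rfl
    simp only [List.pairwise_cons, List.mem_cons, List.not_mem_nil, or_false,
      forall_eq_or_imp, forall_eq] at hp
    clear h
    obtain rfl : a = 0 := by omega
    obtain rfl : b = 2 * k := by omega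
    have : (c = 2 * k + 1 ∧ e = 2 * k + 2 ∧ f = 2 * k + 3) ∨
        (c = 2 * k + 1 ∧ e = 2 * k + 2 ∧ f = 2 * k + 4) ∨
        (c = 2 * k + 1 ∧ e = 2 * k + 3 ∧ f = 2 * k + 4) ∨
        (c = 2 * k + 2 ∧ e = 2 * k + 3 ∧ f = 2 * k + 4) := by
      omega
    rcases this with ⟨rfl, rfl, rfl⟩ | ⟨rfl, rfl, rfl⟩ | ⟨rfl, rfl, rfl⟩ | ⟨rfl, rfl, rfl⟩
    · exact Or.inr ⟨3, rfl⟩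
    · exact Or.inr ⟨4, rfl⟩
    · exact Or.inr ⟨5, rfl⟩
    · exact Or.inr ⟨6, rfl⟩
  | [a, b, c, e, f, g] =>
    have h0 := h 0 a rfl
    have h1 := h 1 b rfl
    have h2 := h 2 c rfl
    have h3 := h 3 e rfl
    have h4 := h 4 f rfl
    have h5 := h 5 g rfl
    simp only [List.pairwise_cons, List.mem_cons, List.not_mem_nil, or_false,
      forall_eq_or_imp, forall_eq] at hp
    clear h
    obtain rfl : a = 0 := by omega
    obtain rfl : b = 2 * k := by omega
    have : (c = 2 * k + 1 ∧ e = 2 * k + 2 ∧ f = 2 * k + 3 ∧ g = 2 * k + 4) := by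
      omega
    obtain ⟨rfl, rfl, rfl, rfl⟩ := this
    exact Or.inr ⟨7, rfl⟩
  | a :: b :: c :: e :: f :: g :: x :: d =>
    have h6 := h 6 x rfl
    omega

/-- The functional of `pathDiagram_moment`. -/
def moment (k : ℕ) (v : ℕ → ℕ → ℝ) : ℝ :=
  4 * (k : ℝ) ^ 2 * v 0 0 + v 2 (2 * k + 1) + 4 * v 2 (2 * k + 2) - 4 * v 3 (2 * k + 2) -
    9 * v 3 (2 * k + 3) + 9 * v 4 (2 * k + 3) + 16 * v 4 (2 * k + 4) - 16 * v 5 (2 * k + 4)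

theorem abs_neg_add_two_mul (c k : ℕ) : |-(c : ℝ) + -(2 * (k : ℝ))| = 2 * k + c := by
  rw [← neg_add, abs_neg, abs_of_nonneg (by positivity), add_comm]

theorem abs_two_mul_add (c k : ℕ) : |2 * (k : ℝ) + c| = 2 * k + c :=
  abs_of_nonneg (by positivity)

/-- Column one has coefficient zero because `(t - 2k)²` vanishes at `2k`; columns zero and two count
positively, and column zero is always present. -/
theorem moment_pos {k : ℕ} (hk : 1 ≤ k) {d : List ℕ}
    (h : d = [0] ∨ d = [0, 2 * k] ∨ d = [0, 2 * k, 2 * k + 1] ∨ d = [0, 2 * k, 2 * k + 2]) :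
    0 < moment k (pureDiagram d) := by
  have hk0 : (0 : ℝ) < k := by exact_mod_cast hk
  have a1 := abs_two_mul_add 1 k
  have a2 := abs_two_mul_add 2 k
  have b1 := abs_neg_add_two_mul 1 k
  have b2 := abs_neg_add_two_mul 2 k
  push_cast at a1 a2 b1 b2
  rcases h with rfl | rfl | rfl | rfl <;> simp [moment, pureDiagram, a1, a2, b1, b2] <;> positivity

/-- Up to a factor this is the divided difference of `(t - 2k)²` at the at least four points of the
sequence, and it vanishes since the degree is two. -/
theorem moment_translatedSequence {k : ℕ} (hk : 1 ≤ k) (s : Fin 8) :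
    moment k (pureDiagram (translatedSequence k s)) = 0 := by
  have hk0 : (0 : ℝ) < k := by exact_mod_cast hk
  have a1 := abs_two_mul_add 1 k
  have a2 := abs_two_mul_add 2 k
  have a3 := abs_two_mul_add 3 k
  have a4 := abs_two_mul_add 4 k
  have b1 := abs_neg_add_two_mul 1 k
  have b2 := abs_neg_add_two_mul 2 k
  have b3 := abs_neg_add_two_mul 3 k
  have b4 := abs_neg_add_two_mul 4 k
  push_cast at a1 a2 a3 a4 b1 b2 b3 b4
  fin_cases s <;>
    simp [moment, pureDiagram, translatedSequence, a1, a2, a3, a4, b1, b2, b3, b4] <;>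
    norm_num [abs_of_pos] <;> field_simp <;> ring

theorem support_of_isDecomposition {k : ℕ} (hk : 1 ≤ k) {w : List ℕ →₀ ℝ}
    (hw : IsDecomposition (pathDiagram k) w) :
    ∀ d ∈ w.support, d ∈ Set.range (translatedSequence k) := by
  have hcases : ∀ d ∈ w.support, _ := fun d hd => degreeSequence_cases (hw.1 d hd)
    fun i j h => mem_pathPositions_of_pathDiagram_ne_zero (k := k) (hw.ne_zero hd h)
  have hsum : ∑ d ∈ w.support, w d * moment k (pureDiagram d) = 0 := by
    rw [← pathDiagram_moment k]
    simp only [hw.2.2, Finsupp.sum, Finset.mul_sum, moment, ← Finset.sum_add_distrib,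
      ← Finset.sum_sub_distrib]
    refine Finset.sum_congr rfl fun d _ => ?_
    ring
  have hnonneg : ∀ d ∈ w.support, 0 ≤ w d * moment k (pureDiagram d) := by
    intro d hd
    refine mul_nonneg (hw.2.1 d) ?_
    rcases hcases d hd with h | ⟨s, rfl⟩
    · exact (moment_pos hk h).le
    · exact (moment_translatedSequence hk s).ge
  intro d hd
  refine (hcases d hd).resolve_left fun h => ?_
  have := (Finset.sum_eq_zero_iff_of_nonneg hnonneg).1 hsum d hd
  exact mul_ne_zero (Finsupp.mem_support_iff.1 hd) (moment_pos hk h).ne' this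

end Pure

/-! ### The triangle of weights -/

section Polytope

/-- The equations of the polytope of weights, position by position. -/
structure PathWeights (k : ℝ) (w : Fin 8 → ℝ) : Prop where
  e₀₀ : w 0 + w 1 + w 2 + w 3 + w 4 + w 5 + w 6 + w 7 = 1
  e₁₀ : w 0 * ((2 * k + 1) * (k + 1)) + w 1 * ((2 * k + 1) * (2 * k + 3) / 3) +
    w 2 * ((k + 1) * (2 * k + 3) / 3) + w 3 * ((2 * k + 1) * (k + 1) * (2 * k + 3) / 3) +
    w 4 * ((2 * k + 1) * (k + 1) * (k + 2) / 2) +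
    w 5 * ((2 * k + 1) * (2 * k + 3) * (k + 2) / 6) +
    w 6 * ((k + 1) * (2 * k + 3) * (k + 2) / 6) +
    w 7 * ((2 * k + 1) * (k + 1) * (2 * k + 3) * (k + 2) / 6) =
      (k + 4) * (k + 3) * (k + 2) * (k + 1) / 24
  e₂₁ : w 0 * (4 * k * (k + 1)) + w 1 * (k * (2 * k + 3)) +
    w 3 * (2 * k * (k + 1) * (2 * k + 3)) + w 4 * (8 * k * (k + 1) * (k + 2) / 3) +
    w 5 * (2 * k * (2 * k + 3) * (k + 2) / 3) +
    w 7 * (4 * k * (k + 1) * (2 * k + 3) * (k + 2) / 3) =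
      (k + 3) * (k + 2) * (k + 1) * k / 6
  e₂₂ : w 2 * (k * (2 * k + 3)) + w 6 * (k * (2 * k + 3) * (k + 2)) = k * (k + 2)
  e₃₂ : w 0 * (k * (2 * k + 1)) + w 3 * (k * (2 * k + 1) * (2 * k + 3)) +
    w 4 * (k * (2 * k + 1) * (k + 2)) + w 7 * (k * (2 * k + 1) * (2 * k + 3) * (k + 2)) =
      (k + 2) * (k + 1) * k * (k - 1) / 4
  e₃₃ : w 1 * (k * (2 * k + 1) / 3) + w 2 * (4 * k * (k + 1) / 3) +
    w 5 * (2 * k * (2 * k + 1) * (k + 2) / 3) + w 6 * (8 * k * (k + 1) * (k + 2) / 3) =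
      2 * k * (k + 1)
  e₄₃ : w 3 * (2 * k * (2 * k + 1) * (k + 1) / 3) +
    w 7 * (4 * k * (2 * k + 1) * (k + 1) * (k + 2) / 3) =
      (k + 1) * k * (k - 1) * (k - 2) / 6
  e₄₄ : w 4 * (k * (2 * k + 1) * (k + 1) / 6) + w 5 * (k * (2 * k + 1) * (2 * k + 3) / 6) +
    w 6 * (k * (k + 1) * (2 * k + 3) / 2) = k ^ 2
  e₅₄ : w 7 * (k * (2 * k + 1) * (k + 1) * (2 * k + 3) / 6) =
    k * (k - 1) * (k - 2) * (k - 3) / 24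

theorem forall_decomposition_iff {k : ℕ} (w : Fin 8 → ℝ) :
    (∀ i j, (pathDiagram k i j : ℝ) = ∑ s, w s * pureDiagram (translatedSequence k s) i j) ↔
      ∀ x ∈ pathPositions k,
        (pathDiagram k x.1 x.2 : ℝ) = ∑ s, w s * pureDiagram (translatedSequence k s) x.1 x.2 := by
  refine ⟨fun h x _ => h x.1 x.2, fun h i j => ?_⟩
  by_cases hx : (i, j) ∈ pathPositions k
  · exact h (i, j) hx
  · rw [not_imp_comm.1 mem_pathPositions_of_pathDiagram_ne_zero hx, Nat.cast_zero, eq_comm]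
    refine Finset.sum_eq_zero fun s _ => mul_eq_zero_of_right _ (pureDiagram_eq_zero fun hs => ?_)
    exact hx (mem_pathPositions_of_translatedSequence hs)

theorem forall_decomposition_iff_pathWeights {k : ℕ} (hk : 1 ≤ k) (w : Fin 8 → ℝ) :
    (∀ i j, (pathDiagram k i j : ℝ) = ∑ s, w s * pureDiagram (translatedSequence k s) i j) ↔
      PathWeights k w := by
  have hk0 : (0 : ℝ) < k := by exact_mod_cast hk
  have a1 := abs_two_mul_add 1 k
  have a2 := abs_two_mul_add 2 k
  have a3 := abs_two_mul_add 3 k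
  have a4 := abs_two_mul_add 4 k
  have b1 := abs_neg_add_two_mul 1 k
  have b2 := abs_neg_add_two_mul 2 k
  have b3 := abs_neg_add_two_mul 3 k
  have b4 := abs_neg_add_two_mul 4 k
  push_cast at a1 a2 a3 a4 b1 b2 b3 b4
  have h00 : ∑ s, w s * pureDiagram (translatedSequence k s) 0 0 =
      w 0 + w 1 + w 2 + w 3 + w 4 + w 5 + w 6 + w 7 := by
    simp [pureDiagram, translatedSequence, Fin.sum_univ_eight, a1, a2, a3, a4]
    field_simp
  have h10 : ∑ s, w s * pureDiagram (translatedSequence k s) 1 (2 * k) =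
      w 0 * ((2 * k + 1) * (k + 1)) + w 1 * ((2 * k + 1) * (2 * k + 3) / 3) +
      w 2 * ((k + 1) * (2 * k + 3) / 3) + w 3 * ((2 * k + 1) * (k + 1) * (2 * k + 3) / 3) +
      w 4 * ((2 * k + 1) * (k + 1) * (k + 2) / 2) +
      w 5 * ((2 * k + 1) * (2 * k + 3) * (k + 2) / 6) +
      w 6 * ((k + 1) * (2 * k + 3) * (k + 2) / 6) +
      w 7 * ((2 * k + 1) * (k + 1) * (2 * k + 3) * (k + 2) / 6) := by
    simp [pureDiagram, translatedSequence, Fin.sum_univ_eight]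
    field_simp
    ring
  have h21 : ∑ s, w s * pureDiagram (translatedSequence k s) 2 (2 * k + 1) =
      w 0 * (4 * k * (k + 1)) + w 1 * (k * (2 * k + 3)) +
      w 3 * (2 * k * (k + 1) * (2 * k + 3)) + w 4 * (8 * k * (k + 1) * (k + 2) / 3) +
      w 5 * (2 * k * (2 * k + 3) * (k + 2) / 3) +
      w 7 * (4 * k * (k + 1) * (2 * k + 3) * (k + 2) / 3) := by
    simp [pureDiagram, translatedSequence, Fin.sum_univ_eight, b1]
    norm_num
    field_simp
    ring
  have h22 : ∑ s, w s * pureDiagram (translatedSequence k s) 2 (2 * k + 2) =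
      w 2 * (k * (2 * k + 3)) + w 6 * (k * (2 * k + 3) * (k + 2)) := by
    simp [pureDiagram, translatedSequence, Fin.sum_univ_eight, b2]
    norm_num
    field_simp
    ring
  have h32 : ∑ s, w s * pureDiagram (translatedSequence k s) 3 (2 * k + 2) =
      w 0 * (k * (2 * k + 1)) + w 3 * (k * (2 * k + 1) * (2 * k + 3)) +
      w 4 * (k * (2 * k + 1) * (k + 2)) + w 7 * (k * (2 * k + 1) * (2 * k + 3) * (k + 2)) := by
    simp [pureDiagram, translatedSequence, Fin.sum_univ_eight, b2]
    norm_num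
    field_simp
    ring
  have h33 : ∑ s, w s * pureDiagram (translatedSequence k s) 3 (2 * k + 3) =
      w 1 * (k * (2 * k + 1) / 3) + w 2 * (4 * k * (k + 1) / 3) +
      w 5 * (2 * k * (2 * k + 1) * (k + 2) / 3) + w 6 * (8 * k * (k + 1) * (k + 2) / 3) := by
    simp [pureDiagram, translatedSequence, Fin.sum_univ_eight, b3]
    norm_num
    field_simp
    ring
  have h43 : ∑ s, w s * pureDiagram (translatedSequence k s) 4 (2 * k + 3) =
      w 3 * (2 * k * (2 * k + 1) * (k + 1) / 3) +
      w 7 * (4 * k * (2 * k + 1) * (k + 1) * (k + 2) / 3) := by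
    simp [pureDiagram, translatedSequence, Fin.sum_univ_eight, b3]
    norm_num
    field_simp
    ring
  have h44 : ∑ s, w s * pureDiagram (translatedSequence k s) 4 (2 * k + 4) =
      w 4 * (k * (2 * k + 1) * (k + 1) / 6) + w 5 * (k * (2 * k + 1) * (2 * k + 3) / 6) +
      w 6 * (k * (k + 1) * (2 * k + 3) / 2) := by
    simp [pureDiagram, translatedSequence, Fin.sum_univ_eight, b4]
    norm_num
    field_simp
    ring
  have h54 : ∑ s, w s * pureDiagram (translatedSequence k s) 5 (2 * k + 4) =
      w 7 * (k * (2 * k + 1) * (k + 1) * (2 * k + 3) / 6) := by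
    simp [pureDiagram, translatedSequence, Fin.sum_univ_eight, b4]
    norm_num
    left
    field_simp
    ring
  rw [forall_decomposition_iff]
  simp only [pathPositions, List.forall_mem_cons, List.not_mem_nil, false_imp_iff, implies_true,
    and_true, h00, h10, h21, h22, h32, h33, h43, h44, h54]
  rw [pathDiagram_zero_zero, pathDiagram_row_one k 1, pathDiagram_row_one k 2,
    pathDiagram_row_one k 3, pathDiagram_row_one k 4, pathDiagram_row_two k 1,
    pathDiagram_row_two k 2, pathDiagram_row_two k 3,
    show pathDiagram k 1 (2 * k) = pathRow₁ k 1 from pathDiagram_row_one k 0]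
  simp only [pathRow₁, pathRow₂, Nat.cast_mul, cast_choose_four]
  push_cast
  constructor
  · rintro ⟨g00, g10, g21, g22, g32, g33, g43, g44, g54⟩
    constructor
    · linear_combination -g00
    · linear_combination -g10
    · linear_combination -g21
    · linear_combination -g22
    · linear_combination -g32
    · linear_combination -g33
    · linear_combination -g43
    · linear_combination -g44
    · linear_combination -g54
  · rintro ⟨g00, g10, g21, g22, g32, g33, g43, g44, g54⟩
    refine ⟨?_, ?_, ?_, ?_, ?_, ?_, ?_, ?_, ?_⟩
    · linear_combination -g00
    · linear_combination -g10
    · linear_combination -g21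
    · linear_combination -g22
    · linear_combination -g32
    · linear_combination -g33
    · linear_combination -g43
    · linear_combination -g44
    · linear_combination -g54

theorem pathWeights_hVertex₁ {k : ℝ} (hk : 0 < k) : PathWeights k (hVertex₁ k) := by
  constructor <;> simp [hVertex₁, wCoord₄, wCoord₈] <;> field_simp <;> ring

theorem pathWeights_hVertex₂ {k : ℝ} (hk : 0 < k) : PathWeights k (hVertex₂ k) := by
  constructor <;> simp [hVertex₂, wCoord₄, wCoord₈] <;> field_simp <;> ring

theorem pathWeights_hVertex₃ {k : ℝ} (hk : 0 < k) : PathWeights k (hVertex₃ k) := by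
  constructor <;> simp [hVertex₃, wCoord₄, wCoord₈] <;> field_simp <;> ring

theorem hVertex_nonneg {k : ℝ} (hk : 3 ≤ k) :
    (∀ s, 0 ≤ hVertex₁ k s) ∧ (∀ s, 0 ≤ hVertex₂ k s) ∧ ∀ s, 0 ≤ hVertex₃ k s := by
  -- In terms of `m = k - 3` all numerators have nonnegative coefficients, including `k ^ 2 - 7`,
  -- which is negative for `k = 2`.
  obtain ⟨m, rfl⟩ : ∃ m, k = m + 3 := ⟨k - 3, by ring⟩
  have hm : 0 ≤ m := by linarith
  have e1 : m + 3 - 1 = m + 2 := by ring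
  have e2 : m + 3 - 2 = m + 1 := by ring
  have e3 : m + 3 - 3 = m := by ring
  have e4 : (m + 3) ^ 2 - 7 = m ^ 2 + 6 * m + 2 := by ring
  refine ⟨fun s => ?_, fun s => ?_, fun s => ?_⟩ <;> fin_cases s <;>
    simp [hVertex₁, hVertex₂, hVertex₃, wCoord₄, wCoord₈, e1, e2, e3, e4] <;> positivity

/-- The barycentric coordinates of a solution of the equations are proportional to its first three
coordinates. -/
theorem PathWeights.eq_combination {k : ℝ} (hk : 0 < k) {w : Fin 8 → ℝ} (hw : PathWeights k w) :
    (w 2 * (2 * k + 3) / (k + 2) + w 1 * ((2 * k + 3) * (2 * k + 1)) / (2 * (k + 2) * (k + 1)) +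
      w 0 * (2 * k + 1) / (k + 2) = 1) ∧
    w = (w 2 * (2 * k + 3) / (k + 2)) • hVertex₁ k +
      (w 1 * ((2 * k + 3) * (2 * k + 1)) / (2 * (k + 2) * (k + 1))) • hVertex₂ k +
      (w 0 * (2 * k + 1) / (k + 2)) • hVertex₃ k := by
  -- Six of the nine equations, cleared of common factors, already determine the plane through the
  -- three vertices.
  have g22 : w 2 * (2 * k + 3) + w 6 * ((2 * k + 3) * (k + 2)) = k + 2 := by
    linear_combination (norm := (field_simp; ring)) (1 / k) * hw.e₂₂
  have g54 : w 7 * (4 * (2 * k + 1) * (k + 1) * (2 * k + 3)) = (k - 1) * (k - 2) * (k - 3) := by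
    linear_combination (norm := (field_simp; ring)) (24 / k) * hw.e₅₄
  have g43 : w 3 * (4 * (2 * k + 1)) + w 7 * (8 * (2 * k + 1) * (k + 2)) =
      (k - 1) * (k - 2) := by
    linear_combination (norm := (field_simp; ring)) (6 / (k * (k + 1))) * hw.e₄₃
  have g44 : w 4 * (2 * (2 * k + 1) * (k + 1)) + w 5 * (2 * (2 * k + 1) * (2 * k + 3)) +
      w 6 * (6 * (k + 1) * (2 * k + 3)) = 12 * k := by
    linear_combination (norm := (field_simp; ring)) (12 / k) * hw.e₄₄
  have g32 : w 0 * (2 * k + 1) + w 3 * ((2 * k + 1) * (2 * k + 3)) +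
      w 4 * ((2 * k + 1) * (k + 2)) + w 7 * ((2 * k + 1) * (2 * k + 3) * (k + 2)) =
      (k + 2) * (k + 1) * (k - 1) / 4 := by
    linear_combination (norm := (field_simp; ring)) (1 / k) * hw.e₃₂
  have g33 : w 1 * (2 * k + 1) + w 2 * (4 * (k + 1)) + w 5 * ((2 * k + 1) * (2 * k + 4)) +
      w 6 * (4 * (k + 1) * (2 * k + 4)) = 6 * (k + 1) := by
    linear_combination (norm := (field_simp; ring)) (3 / k) * hw.e₃₃
  -- Eliminating `w 3, …, w 7` leaves one relation among the first three coordinates: the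
  -- barycentric coordinates sum to one.
  have gsum : w 1 * ((2 * k + 1) * (2 * k + 3)) + w 2 * (2 * (k + 1) * (2 * k + 3)) +
      w 0 * (2 * (k + 1) * (2 * k + 1)) = 2 * (k + 1) * (k + 2) := by
    linear_combination (2 * k + 3) * g33 - (k + 2) * g44 - 2 * (k + 1) * g22 +
      2 * (k + 1) * g32 - (k + 1) * (2 * k + 3) / 2 * g43 + (k + 2) / 2 * g54
  have gfour : w 4 = (w 2 * (2 * k + 3) / (k + 2)) * hVertex₁ k 4 +
      (w 1 * ((2 * k + 3) * (2 * k + 1)) / (2 * (k + 2) * (k + 1))) * hVertex₂ k 4 +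
      (w 0 * (2 * k + 1) / (k + 2)) * hVertex₃ k 4 := by
    simp only [hVertex₁, hVertex₂, hVertex₃, Matrix.cons_val]
    linear_combination (norm := (field_simp; ring)) (1 / ((2 * k + 1) * (k + 2))) * g32 -
      ((2 * k + 3) / (4 * (2 * k + 1) * (k + 2))) * g43 + (1 / (4 * (2 * k + 1) * (k + 1))) * g54 -
      ((2 * k + 5) * (k - 1) / (2 * (2 * k + 1) * (k + 2) ^ 2 * (k + 1) ^ 2)) * gsum
  have gsix : w 6 = (w 2 * (2 * k + 3) / (k + 2)) * hVertex₁ k 6 +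
      (w 1 * ((2 * k + 3) * (2 * k + 1)) / (2 * (k + 2) * (k + 1))) * hVertex₂ k 6 +
      (w 0 * (2 * k + 1) / (k + 2)) * hVertex₃ k 6 := by
    simp only [hVertex₁, hVertex₂, hVertex₃, Matrix.cons_val]
    linear_combination (norm := (field_simp; ring)) (1 / ((2 * k + 3) * (k + 2))) * g22 -
      (1 / (2 * (k + 1) * (k + 2) * (2 * k + 3))) * gsum
  have gfive : w 5 = (w 2 * (2 * k + 3) / (k + 2)) * hVertex₁ k 5 +
      (w 1 * ((2 * k + 3) * (2 * k + 1)) / (2 * (k + 2) * (k + 1))) * hVertex₂ k 5 +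
      (w 0 * (2 * k + 1) / (k + 2)) * hVertex₃ k 5 := by
    simp only [hVertex₁, hVertex₂, hVertex₃, Matrix.cons_val] at gfour gsix ⊢
    linear_combination (norm := (field_simp; ring)) (1 / (2 * (2 * k + 1) * (2 * k + 3))) * g44 -
      ((k + 1) / (2 * k + 3)) * gfour - (3 * (k + 1) / (2 * k + 1)) * gsix -
      (3 * k / ((k + 1) * (k + 2) * (2 * k + 1) * (2 * k + 3))) * gsum
  have hone : w 2 * (2 * k + 3) / (k + 2) +
      w 1 * ((2 * k + 3) * (2 * k + 1)) / (2 * (k + 2) * (k + 1)) +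
      w 0 * (2 * k + 1) / (k + 2) = 1 := by
    linear_combination (norm := (field_simp; ring)) (1 / (2 * (k + 1) * (k + 2))) * gsum
  have h7 : w 7 = wCoord₈ k := by
    rw [wCoord₈, eq_div_iff (by positivity)]
    linear_combination g54
  have h3 : w 3 = wCoord₄ k := by
    rw [wCoord₄, eq_div_iff (by positivity)]
    linear_combination (2 * k + 3) * (k + 1) * g43 - 2 * (k + 2) * g54
  refine ⟨hone, ?_⟩
  funext s
  fin_cases s
  · simp [hVertex₁, hVertex₂, hVertex₃]
    field_simp
  · simp [hVertex₁, hVertex₂, hVertex₃]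
    field_simp
  · simp [hVertex₁, hVertex₂, hVertex₃]
    field_simp
  · simp only [Pi.add_apply, Pi.smul_apply, smul_eq_mul, hVertex₁, hVertex₂, hVertex₃]
    simp only [Fin.reduceFinMk, Matrix.cons_val, ← add_mul, hone, one_mul, h3]
  · exact gfour
  · exact gfive
  · exact gsix
  · simp only [Pi.add_apply, Pi.smul_apply, smul_eq_mul, hVertex₁, hVertex₂, hVertex₃]
    simp only [Fin.reduceFinMk, Matrix.cons_val, ← add_mul, hone, one_mul, h7]

theorem convex_decompositionPolytope {m : ℕ} (β : ℕ → ℕ → ℕ) (D : Fin m → List ℕ) :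
    Convex ℝ (decompositionPolytope β D) := by
  rintro x ⟨hx, hx'⟩ y ⟨hy, hy'⟩ a b ha hb hab
  refine ⟨fun s => add_nonneg (mul_nonneg ha (hx s)) (mul_nonneg hb (hy s)), fun i j => ?_⟩
  have h : ∑ s, (a • x + b • y) s * pureDiagram (D s) i j =
      a * ∑ s, x s * pureDiagram (D s) i j + b * ∑ s, y s * pureDiagram (D s) i j := by
    rw [Finset.mul_sum, Finset.mul_sum, ← Finset.sum_add_distrib]
    refine Finset.sum_congr rfl fun s _ => ?_
    simp only [Pi.add_apply, Pi.smul_apply, smul_eq_mul]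
    ring
  rw [h, ← hx', ← hy', ← add_mul, hab, one_mul]

theorem decompositionPolytope_eq {k : ℕ} (hk : 3 ≤ k) :
    decompositionPolytope (pathDiagram k) (translatedSequence k) =
      convexHull ℝ {hVertex₁ (k : ℝ), hVertex₂ (k : ℝ), hVertex₃ (k : ℝ)} := by
  have hk3 : (3 : ℝ) ≤ k := by exact_mod_cast hk
  have hk0 : (0 : ℝ) < k := by linarith
  have hmem : ∀ w, w ∈ decompositionPolytope (pathDiagram k) (translatedSequence k) ↔
      (∀ s, 0 ≤ w s) ∧ PathWeights k w := fun w =>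
    and_congr_right fun _ => forall_decomposition_iff_pathWeights (by omega) w
  apply Set.Subset.antisymm
  · intro w hw
    rw [hmem] at hw
    obtain ⟨h0, hw⟩ := hw
    -- Only the signs of the first three coordinates are needed to make this a convex combination.
    obtain ⟨hone, hcomb⟩ := hw.eq_combination hk0
    have w0 := h0 0
    have w1 := h0 1
    have w2 := h0 2
    have h := (convex_convexHull ℝ {hVertex₁ (k : ℝ), hVertex₂ (k : ℝ), hVertex₃ (k : ℝ)}).sum_mem
      (t := Finset.univ)
      (w := ![w 2 * (2 * k + 3) / (k + 2),
        w 1 * ((2 * k + 3) * (2 * k + 1)) / (2 * (k + 2) * (k + 1)), w 0 * (2 * k + 1) / (k + 2)])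
      (z := ![hVertex₁ (k : ℝ), hVertex₂ (k : ℝ), hVertex₃ (k : ℝ)])
      (by
        intro i _
        fin_cases i <;> simp <;> positivity)
      (by simpa [Fin.sum_univ_three] using hone)
      (by
        intro i _
        apply subset_convexHull
        fin_cases i <;> simp)
    rw [hcomb]
    simpa [Fin.sum_univ_three] using h
  · refine convexHull_min ?_ (convex_decompositionPolytope _ _)
    obtain ⟨n1, n2, n3⟩ := hVertex_nonneg hk3
    rintro w (rfl | rfl | rfl)
    · exact (hmem _).2 ⟨n1, pathWeights_hVertex₁ hk0⟩
    · exact (hmem _).2 ⟨n2, pathWeights_hVertex₂ hk0⟩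
    · exact (hmem _).2 ⟨n3, pathWeights_hVertex₃ hk0⟩

/-- On the first three coordinates the vertices form an antidiagonal matrix with nonzero entries, so
they are even linearly independent. -/
theorem affineIndependent_hVertex {k : ℝ} (hk : 0 < k) :
    AffineIndependent ℝ ![hVertex₁ k, hVertex₂ k, hVertex₃ k] := by
  refine LinearIndependent.affineIndependent (k := ℝ) ?_
  rw [Fintype.linearIndependent_iff]
  intro g hg
  rw [Fin.sum_univ_three] at hg
  have h0 := congrFun hg 0
  have h1 := congrFun hg 1
  have h2 := congrFun hg 2
  simp [hVertex₁, hVertex₂, hVertex₃] at h0 h1 h2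
  have p1 : k + 2 ≠ 0 := by positivity
  have p2 : 2 * k + 1 ≠ 0 := by positivity
  have p3 : 2 * k + 3 ≠ 0 := by positivity
  have p4 : k + 1 ≠ 0 := by positivity
  intro i
  fin_cases i <;> simp_all

end Polytope

theorem mainTheorem2 {K : Type*} [Field K] (k : ℕ) (hk : 1 ≤ k) :
    Nonempty (MinimalFreeResolution K 6 (pathIdeal K ^ k)) ∧
    ∀ F : MinimalFreeResolution K 6 (pathIdeal K ^ k),
      (∀ i j, F.betti i j = pathDiagram k i j) ∧
      (∀ w : List ℕ →₀ ℝ, IsDecomposition F.betti w →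
        ∀ d ∈ w.support, d ∈ Set.range (translatedSequence k)) ∧
      (3 ≤ k →
        decompositionPolytope F.betti (translatedSequence k) =
            convexHull ℝ {hVertex₁ (k : ℝ), hVertex₂ (k : ℝ), hVertex₃ (k : ℝ)} ∧
          AffineIndependent ℝ ![hVertex₁ (k : ℝ), hVertex₂ (k : ℝ), hVertex₃ (k : ℝ)]) := by
  obtain ⟨G, hG⟩ := exists_resolution_pathIdeal_pow K hk
  refine ⟨⟨G⟩, fun F => ?_⟩
  have hF : F.betti = pathDiagram k := by
    funext i j
    rw [F.betti_eq G (homogeneousComponent_mem_pathIdeal_pow K k), hG]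
  rw [hF]
  exact ⟨fun _ _ => rfl, fun w hw => support_of_isDecomposition hk hw, fun hk3 =>
    ⟨decompositionPolytope_eq hk3, affineIndependent_hVertex (by exact_mod_cast hk)⟩⟩
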